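/- Theorem 1. Let $\sigma \in L_2(0,\pi)$ be complex-valued and let $r_1, r_2 \in \mathbb C[\lambda]$ be relatively prime. Consider the boundary value problem $\mathcal L = \mathcal L(\sigma, r_1, r_2)$: $-y'' + \sigma' y = \lambda y$ on $(0,\pi)$, $y^{[1]}(0) = 0$, $r_1(\lambda) y^{[1]}(\pi) + r_2(\lambda) y(\pi) = 0$, where $\sigma'$ is the derivative in the sense of distributions and $y^{[1]} := y' - \sigma y$ is the quasi-derivative. The equation is understood as follows: $y$ and $y^{[1]}$ are absolutely continuous on $[0,\pi]$ and $-(y^{[1]})' - \sigma y^{[1]} - \sigma^2 y = \lambda y$ almost everywhere on $(0,\pi)$. The pair $(r_1, r_2)$ is assumed to be normalized: if $\deg r_1 \ge \deg r_2$, then $r_1$ is monic, and if $\deg r_1 < \deg r_2$, then $r_2$ is monic (with $\deg 0 = -\infty$). Let $\psi(x,\lambda)$ be the solution of the equation with $\psi(\pi,\lambda) = r_1(\lambda)$, $\psi^{[1]}(\pi,\lambda) = -r_2(\lambda)$. The Weyl function of $\mathcal L$ is the meromorphic function $M(\lambda) = -\psi(0,\lambda)/\psi^{[1]}(0,\lambda)$.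 Let $\tilde{\mathcal L} = \mathcal L(\tilde\sigma, \tilde r_1, \tilde r_2)$ be another problem of the same form, with $\tilde\sigma \in L_2(0,\pi)$ complex-valued, $\tilde r_1, \tilde r_2$ relatively prime and $(\tilde r_1, \tilde r_2)$ normalized, and let $\tilde M$ be its Weyl function. If $M(\lambda) = \tilde M(\lambda)$ (at every $\lambda$ at which both are defined), then $\sigma(x) = \tilde\sigma(x)$ for a.e. $x \in (0,\pi)$, $r_1 = \tilde r_1$ and $r_2 = \tilde r_2$. -/

import Mathlib

/-- `y` solves `-(y^{[1]})' - σ y^{[1]} - σ² y = lam y` on `(0, π)`, where `y₁` is the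
quasi-derivative `y^{[1]} = y' - σ y`: both functions are absolutely continuous on `[0, π]` and
the two equations hold almost everywhere on `(0, π)`. For locally integrable `q = σ'` this is
`-y'' + q y = lam y`; in general it is the regularisation of that equation for `q` the
distributional derivative of `σ`. -/
structure IsQuasiSolution (σ : ℝ → ℂ) (lam : ℂ) (y y₁ : ℝ → ℂ) : Prop where
  absolutelyContinuous : AbsolutelyContinuousOnInterval y 0 Real.pi
  absolutelyContinuous_quasi : AbsolutelyContinuousOnInterval y₁ 0 Real.pi
  hasDerivAt : ∀ᵐ x ∂(MeasureTheory.volume.restrict (Set.Ioo (0 : ℝ) Real.pi)),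
    HasDerivAt y (y₁ x + σ x * y x) x
  hasDerivAt_quasi : ∀ᵐ x ∂(MeasureTheory.volume.restrict (Set.Ioo (0 : ℝ) Real.pi)),
    HasDerivAt y₁ (-(σ x * y₁ x) - σ x ^ 2 * y x - lam * y x) x

/-- `ψ`, with quasi-derivative `ψ₁`, is the solution `ψ(·, lam)` determined on `[0, π]` by
`ψ(π, lam) = r₁(lam)` and `ψ^{[1]}(π, lam) = -r₂(lam)`. -/
structure IsPsi (σ : ℝ → ℂ) (r₁ r₂ : Polynomial ℂ) (lam : ℂ) (ψ ψ₁ : ℝ → ℂ) : Prop where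
  isQuasiSolution : IsQuasiSolution σ lam ψ ψ₁
  apply_pi : ψ Real.pi = r₁.eval lam
  quasi_apply_pi : ψ₁ Real.pi = -r₂.eval lam

/-- The Weyl function `M(lam) = -ψ(0, lam) / ψ^{[1]}(0, lam)` of the problem with data
`σ, r₁, r₂` is defined at `lam` (its denominator does not vanish there) and has the value `m`. -/
def HasWeylValue (σ : ℝ → ℂ) (r₁ r₂ : Polynomial ℂ) (lam m : ℂ) : Prop :=
  ∃ ψ ψ₁ : ℝ → ℂ, IsPsi σ r₁ r₂ lam ψ ψ₁ ∧ ψ₁ 0 ≠ 0 ∧ m = -(ψ 0 / ψ₁ 0)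

/-- The normalization of a pair of polynomials: the one of larger degree is monic, and `r₁` is
monic if the degrees agree (the zero polynomial has degree `⊥`). -/
def IsNormalizedPair (r₁ r₂ : Polynomial ℂ) : Prop :=
  (r₂.degree ≤ r₁.degree ∧ r₁.Monic) ∨ (r₁.degree < r₂.degree ∧ r₂.Monic)

/-!
The argument is the one of Borg–Marchenko theory in Bennewitz's form: the Green's function decays
off the positive half-line, whatever the coefficient and the boundary condition at `π`, so two
problems with the same Weyl function have to share their solutions.

Let `φ`, `S` be the solutions with `(y, y^{[1]})(0)` equal to `(1, 0)` and `(0, 1)`; a Neumann series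
for a Volterra operator makes them entire in `lam` (`exists_entire_solution`). Where the Weyl
function `M` is defined, `S - M φ` is a multiple of `ψ`. If the Weyl functions of the two problems
agree, then the entire function
`φ S' - S φ' = φ (S' - M φ') - φ' (S - M φ)`,
with primes for the second problem, no longer contains `M` on the left. Put `lam = -κ²`. For large
`κ` in the sector `‖κ‖ ≤ 2 re κ` one has `φ = O(e^{re κ x})` and `S - M φ = O(e^{-re κ x} / ‖κ‖)`
(`IsQuasiSolution.exists_sectorial_bounds`, applied from `0` and, after reflection, from `π`), so the
right-hand side is `O(1 / ‖κ‖)`. These bounds treat the modes `κ y ± y^{[1]}`, which are coupled by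
`σ` and `σ² / κ`; the coupling is small since exponential weights of rate `‖κ‖` have `L²` norm
`O(‖κ‖^{-1/2})`. The same estimate shows that `ψ^{[1]}(0)` does not vanish there, so that the
hypothesis on the Weyl functions is not vacuous. As the left-hand side has order `1 / 2`
(`IsQuasiSolution.exists_norm_le_exp`), the Phragmén–Lindelöf principle and Liouville's theorem
give `φ S' = S φ'` (`eq_zero_of_growth_of_decay`).

Comparing Wronskians yields `φ = φ'` and `S = S'`, and these solutions determine `σ`, not merely its
distributional derivative, because their quasi-derivatives are prescribed at `0`
(`IsFundamentalSystem.coefficient_unique`). Both boundary pairs are then proportional to the values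
at `π` of the common solution `S - M φ`, whence `r₁ r₂' = r₁' r₂`; coprimality and the normalization
do the rest.
-/

open MeasureTheory Set Filter Topology

/-! ### Absolutely continuous functions -/

theorem ae_restrict_Ioo_iff {a b : ℝ} {p : ℝ → Prop} :
    (∀ᵐ x ∂volume.restrict (Ioo a b), p x) ↔ ∀ᵐ x, x ∈ Icc a b → p x := by
  rw [← ae_restrict_iff' measurableSet_Icc]
  constructor
  · intro h; rwa [Measure.restrict_congr_set Ioo_ae_eq_Icc] at h
  · intro h; rwa [Measure.restrict_congr_set Ioo_ae_eq_Icc]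

section AbsolutelyContinuous

variable {E : Type*} [NormedAddCommGroup E] [NormedSpace ℝ E]

theorem AbsolutelyContinuousOnInterval.of_dist_le {X : Type*} [PseudoMetricSpace X]
    {f : ℝ → X} {h : ℝ → ℝ} {a b : ℝ}
    (hh : AbsolutelyContinuousOnInterval h a b)
    (H : ∀ x ∈ uIcc a b, ∀ y ∈ uIcc a b, dist (f x) (f y) ≤ dist (h x) (h y)) :
    AbsolutelyContinuousOnInterval f a b := by
  rw [absolutelyContinuousOnInterval_iff] at hh ⊢
  intro ε hε
  obtain ⟨δ, hδ, h1⟩ := hh ε hε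
  refine ⟨δ, hδ, fun I hI hI' ↦ lt_of_le_of_lt ?_ (h1 I hI hI')⟩
  exact Finset.sum_le_sum fun i hi ↦ H _ (hI.1 i hi).1 _ (hI.1 i hi).2

/-- A primitive of a vector-valued integrable function is absolutely continuous, being dominated
by the primitive of the norm. -/
theorem absolutelyContinuousOnInterval_integral {g : ℝ → E} {a b : ℝ}
    (hg : IntervalIntegrable g volume a b) :
    AbsolutelyContinuousOnInterval (fun x ↦ ∫ t in a..x, g t) a b := by
  refine (hg.norm.absolutelyContinuousOnInterval_intervalIntegral left_mem_uIcc).of_dist_le ?_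
  intro x hx y hy
  have key : ∀ z ∈ uIcc a b, IntervalIntegrable g volume a z := fun z hz ↦
    hg.mono_set (uIcc_subset_uIcc left_mem_uIcc hz)
  rw [dist_eq_norm, dist_eq_norm,
    intervalIntegral.integral_interval_sub_left (key x hx) (key y hy),
    intervalIntegral.integral_interval_sub_left (key x hx).norm (key y hy).norm, Real.norm_eq_abs]
  exact intervalIntegral.norm_integral_le_abs_integral_norm

theorem AbsolutelyContinuousOnInterval.congr {X : Type*} [PseudoMetricSpace X] {f g : ℝ → X}
    {a b : ℝ} (hf : AbsolutelyContinuousOnInterval f a b) (h : EqOn f g (uIcc a b)) :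
    AbsolutelyContinuousOnInterval g a b := by
  rw [absolutelyContinuousOnInterval_iff] at hf ⊢
  intro ε hε
  obtain ⟨δ, hδ, h1⟩ := hf ε hε
  refine ⟨δ, hδ, fun I hI hI' ↦ lt_of_le_of_lt (le_of_eq ?_) (h1 I hI hI')⟩
  exact Finset.sum_congr rfl fun i hi ↦ by rw [h (hI.1 i hi).1, h (hI.1 i hi).2]

/-- The fundamental theorem of calculus for vector-valued absolutely continuous functions with a
prescribed derivative almost everywhere. -/
theorem AbsolutelyContinuousOnInterval.eq_add_integral [CompleteSpace E] {f g : ℝ → E} {a b : ℝ}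
    (hab : a ≤ b) (hf : AbsolutelyContinuousOnInterval f a b)
    (hg : IntervalIntegrable g volume a b)
    (hd : ∀ᵐ x ∂volume.restrict (Ioo a b), HasDerivAt f (g x) x) {x : ℝ} (hx : x ∈ Icc a b) :
    f x = f a + ∫ t in a..x, g t := by
  rw [ae_restrict_Ioo_iff, ← uIcc_of_le hab] at hd
  rw [← uIcc_of_le hab] at hx
  have h0 : ∀ᵐ x, x ∈ uIcc a b → HasDerivAt (f - fun x ↦ ∫ t in a..x, g t) 0 x := by
    filter_upwards [hd, hg.ae_hasDerivAt_integral] with x h1 h2 h3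
    simpa using (h1 h3).sub (h2 h3 a left_mem_uIcc)
  obtain ⟨C, hC⟩ := (hf.sub (absolutelyContinuousOnInterval_integral hg)).const_of_ae_hasDerivAt_zero
    h0
  have h1 := hC x hx
  have h2 := hC a left_mem_uIcc
  simp only [Pi.sub_apply, intervalIntegral.integral_same, sub_zero] at h1 h2
  rw [h2, ← h1]; abel

theorem AbsolutelyContinuousOnInterval.eq_left_of_ae_hasDerivAt_zero {f : ℝ → E} {a b : ℝ}
    (hab : a ≤ b) (hf : AbsolutelyContinuousOnInterval f a b)
    (hd : ∀ᵐ x ∂volume.restrict (Ioo a b), HasDerivAt f 0 x) {x : ℝ} (hx : x ∈ Icc a b) :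
    f x = f a := by
  rw [ae_restrict_Ioo_iff, ← uIcc_of_le hab] at hd
  obtain ⟨C, hC⟩ := hf.const_of_ae_hasDerivAt_zero hd
  rw [← uIcc_of_le hab] at hx
  rw [hC x hx, hC a left_mem_uIcc]

theorem AbsolutelyContinuousOnInterval.pow_of_real {h : ℝ → ℝ} {a b : ℝ}
    (hh : AbsolutelyContinuousOnInterval h a b) (n : ℕ) :
    AbsolutelyContinuousOnInterval (fun x ↦ h x ^ n) a b := by
  induction n with
  | zero =>
    simp only [pow_zero]
    exact contDiff_const.contDiffOn.absolutelyContinuousOnInterval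
  | succ n ih => simpa only [pow_succ] using ih.fun_mul hh

end AbsolutelyContinuous

/-! ### Volterra operators and linear systems with integrable coefficients -/

section Volterra

variable {E : Type*} [NormedAddCommGroup E] [NormedSpace ℂ E] {b : ℝ}

theorem intervalIntegrable_clm_apply {A : ℝ → E →L[ℂ] E} {Y : ℝ → E} {a b : ℝ}
    (hA : IntervalIntegrable A volume a b) (hY : Continuous Y) :
    IntervalIntegrable (fun t ↦ A t (Y t)) volume a b := by
  obtain ⟨C, hC⟩ := (isCompact_uIcc (a := a) (b := b)).exists_bound_of_continuousOn hY.continuousOn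
  have hm : AEStronglyMeasurable (fun t ↦ A t (Y t)) (volume.restrict (uIoc a b)) := by
    have h1 := hA.aestronglyMeasurable_restrict_uIoc
    have h2 : AEStronglyMeasurable Y (volume.restrict (uIoc a b)) := hY.aestronglyMeasurable
    exact (isBoundedBilinearMap_apply (𝕜 := ℂ) (E := E) (F := E)).continuous.comp_aestronglyMeasurable
      (h1.prodMk h2)
  refine (hA.norm.mul_const C).mono_fun' hm ?_
  rw [EventuallyLE, ae_restrict_iff' measurableSet_uIoc]
  filter_upwards with t ht
  exact ((A t).le_opNorm _).trans
    (mul_le_mul_of_nonneg_left (hC t (uIoc_subset_uIcc ht)) (norm_nonneg _))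

theorem continuous_volterra (hb : 0 ≤ b) {A : ℝ → E →L[ℂ] E}
    (hA : IntervalIntegrable A volume 0 b) (Y : C(Icc (0 : ℝ) b, E)) :
    Continuous fun x : Icc (0 : ℝ) b ↦ ∫ t in (0 : ℝ)..x, A t (IccExtend hb Y t) := by
  have hI : IntegrableOn (fun t ↦ A t (IccExtend hb Y t)) (uIcc 0 b) := by
    rw [uIcc_of_le hb]
    exact (intervalIntegrable_iff_integrableOn_Icc_of_le hb).1
      (intervalIntegrable_clm_apply hA (Y.continuous.Icc_extend' (h := hb)))
  have h := intervalIntegral.continuousOn_primitive_interval hI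
  rw [uIcc_of_le hb] at h
  exact continuousOn_iff_continuous_domRestrict.1 h

/-- The Volterra operator `(V Y)(x) = ∫₀ˣ A(t) Y(t) dt` on `C([0, b], E)`. -/
noncomputable def volterra [CompleteSpace E] (hb : 0 ≤ b) (A : ℝ → E →L[ℂ] E)
    (hA : IntervalIntegrable A volume 0 b) : C(Icc (0 : ℝ) b, E) →L[ℂ] C(Icc (0 : ℝ) b, E) :=
  LinearMap.mkContinuous
    { toFun := fun Y ↦
        { toFun := fun x ↦ ∫ t in (0 : ℝ)..x, A t (IccExtend hb Y t)
          continuous_toFun := continuous_volterra hb hA Y }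
      map_add' := fun Y Z ↦ by
        ext x
        have hx : uIcc 0 (x : ℝ) ⊆ uIcc 0 b := by
          rw [uIcc_of_le hb, uIcc_of_le x.2.1]; exact Icc_subset_Icc_right x.2.2
        have h := fun W : C(Icc (0 : ℝ) b, E) ↦
          intervalIntegrable_clm_apply (hA.mono_set hx) (W.continuous.Icc_extend' (h := hb))
        simp only [ContinuousMap.coe_mk, ContinuousMap.add_apply]
        rw [← intervalIntegral.integral_add (h Y) (h Z)]
        simp [IccExtend]
      map_smul' := fun c Y ↦ by
        ext x
        simp only [ContinuousMap.coe_mk, ContinuousMap.smul_apply, RingHom.id_apply]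
        rw [← intervalIntegral.integral_smul]
        simp [IccExtend] }
    (∫ t in (0 : ℝ)..b, ‖A t‖) (fun Y ↦ by
      refine (ContinuousMap.norm_le _ (mul_nonneg
        (intervalIntegral.integral_nonneg hb fun _ _ ↦ norm_nonneg _) (norm_nonneg _))).2 fun x ↦ ?_
      have hx : uIcc 0 (x : ℝ) ⊆ uIcc 0 b := by
        rw [uIcc_of_le hb, uIcc_of_le x.2.1]; exact Icc_subset_Icc_right x.2.2
      simp only [LinearMap.coe_mk, AddHom.coe_mk]
      refine (intervalIntegral.norm_integral_le_of_norm_le x.2.1 (g := fun t ↦ ‖A t‖ * ‖Y‖)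
        (ae_of_all _ fun t _ ↦ ?_) ((hA.mono_set hx).norm.mul_const _)).trans ?_
      · exact ((A t).le_opNorm _).trans
          (mul_le_mul_of_nonneg_left (Y.norm_coe_le_norm _) (norm_nonneg _))
      · rw [intervalIntegral.integral_mul_const]
        refine mul_le_mul_of_nonneg_right ?_ (norm_nonneg _)
        exact intervalIntegral.integral_mono_interval le_rfl x.2.1 x.2.2
          (ae_of_all _ fun _ ↦ norm_nonneg _) hA.norm)

variable [CompleteSpace E]

theorem volterra_apply (hb : 0 ≤ b) {A : ℝ → E →L[ℂ] E} (hA : IntervalIntegrable A volume 0 b)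
    (Y : C(Icc (0 : ℝ) b, E)) (x : Icc (0 : ℝ) b) :
    volterra hb A hA Y x = ∫ t in (0 : ℝ)..x, A t (IccExtend hb Y t) := rfl

/-- The iterates of a Volterra operator decay factorially. -/
theorem norm_volterra_pow_apply_le (hb : 0 ≤ b) {A : ℝ → E →L[ℂ] E}
    (hA : IntervalIntegrable A volume 0 b) (n : ℕ) (Y : C(Icc (0 : ℝ) b, E)) (x : Icc (0 : ℝ) b) :
    ‖(volterra hb A hA ^ n) Y x‖ ≤ ‖Y‖ * ((∫ t in (0 : ℝ)..x, ‖A t‖) ^ n / n.factorial) := by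
  induction n generalizing x with
  | zero => simpa using Y.norm_coe_le_norm x
  | succ n ih =>
    have hx : uIcc 0 (x : ℝ) ⊆ uIcc 0 b := by
      rw [uIcc_of_le hb, uIcc_of_le x.2.1]; exact Icc_subset_Icc_right x.2.2
    set h : ℝ → ℝ := fun s ↦ ∫ t in (0 : ℝ)..s, ‖A t‖ with hh
    have hAC : AbsolutelyContinuousOnInterval h 0 x :=
      absolutelyContinuousOnInterval_integral (hA.mono_set hx).norm
    have hint : IntervalIntegrable (fun t ↦ ‖A t‖ * h t ^ n) volume 0 x :=
      (hA.mono_set hx).norm.mul_continuousOn (hAC.continuousOn.pow n)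
    have hFTC : h x ^ (n + 1) / (n + 1) = ∫ t in (0 : ℝ)..x, ‖A t‖ * h t ^ n := by
      have h1 := (hAC.pow_of_real (n + 1)).eq_add_integral (g := fun t ↦ (n + 1) * (‖A t‖ * h t ^ n))
        x.2.1 (hint.const_mul _) (by
          rw [ae_restrict_Ioo_iff]
          filter_upwards [(hA.mono_set hx).norm.ae_hasDerivAt_integral] with t ht ht'
          rw [uIcc_of_le x.2.1] at ht
          have := (ht ht' 0 ⟨le_rfl, x.2.1⟩).pow (n + 1)
          convert! this using 1
          push_cast; ring) (right_mem_Icc.2 x.2.1)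
      rw [intervalIntegral.integral_const_mul] at h1
      have h0 : h 0 = 0 := by simp [hh]
      rw [h1, h0]
      field_simp; simp
    rw [pow_succ', mul_apply_eq_comp, volterra_apply]
    refine (intervalIntegral.norm_integral_le_of_norm_le x.2.1
      (g := fun t ↦ ‖Y‖ / n.factorial * (‖A t‖ * h t ^ n))
        (ae_of_all _ fun t ht ↦ ?_) (hint.const_mul _)).trans (le_of_eq ?_)
    · have htb : t ∈ Icc (0 : ℝ) b := ⟨ht.1.le, ht.2.trans x.2.2⟩
      rw [IccExtend_of_mem hb _ htb]
      refine ((A t).le_opNorm _).trans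
        ((mul_le_mul_of_nonneg_left (ih ⟨t, htb⟩) (norm_nonneg _)).trans (le_of_eq ?_))
      simp only [hh]; ring
    · rw [intervalIntegral.integral_const_mul, ← hFTC, Nat.factorial_succ]
      push_cast
      field_simp
      simp only [hh]

theorem isUnit_one_sub_volterra (hb : 0 ≤ b) {A : ℝ → E →L[ℂ] E}
    (hA : IntervalIntegrable A volume 0 b) : IsUnit (1 - volterra hb A hA) := by
  set V := volterra hb A hA with hV
  set H := ∫ t in (0 : ℝ)..b, ‖A t‖ with hH
  have hH0 : 0 ≤ H := intervalIntegral.integral_nonneg hb fun _ _ ↦ norm_nonneg _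
  obtain ⟨n, hn⟩ := ((FloorSemiring.tendsto_pow_div_factorial_atTop H).eventually
    (gt_mem_nhds one_pos)).exists
  have hlt : ‖V ^ n‖ < 1 := by
    refine lt_of_le_of_lt (ContinuousLinearMap.opNorm_le_bound _ (by positivity) fun Y ↦ ?_) hn
    refine (ContinuousMap.norm_le _ (by positivity)).2 fun x ↦
      (norm_volterra_pow_apply_le hb hA n Y x).trans ?_
    rw [mul_comm]
    have h1 : ∫ t in (0 : ℝ)..x, ‖A t‖ ≤ H := intervalIntegral.integral_mono_interval le_rfl
      x.2.1 x.2.2 (ae_of_all _ fun _ ↦ norm_nonneg _) hA.norm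
    have h0 : 0 ≤ ∫ t in (0 : ℝ)..x, ‖A t‖ :=
      intervalIntegral.integral_nonneg x.2.1 fun _ _ ↦ norm_nonneg _
    gcongr
  have hu : IsUnit (1 - V ^ n) := by
    have := isUnit_one_sub_of_norm_lt_one (x := V ^ n) hlt
    convert! this
  rw [← mul_neg_geom_sum] at hu
  have hc : Commute (1 - V) (∑ i ∈ Finset.range n, V ^ i) :=
    Commute.sum_right _ _ _ fun i _ ↦
      (Commute.one_left _).sub_left ((Commute.refl V).pow_right i)
  exact (hc.isUnit_mul_iff.1 hu).1

theorem differentiable_inverse_one_sub_add_smul {R : Type*} [NormedRing R] [NormedAlgebra ℂ R]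
    [CompleteSpace R] (a b : R) (h : ∀ z : ℂ, IsUnit (1 - (a + z • b))) :
    Differentiable ℂ fun z : ℂ ↦ Ring.inverse (1 - (a + z • b)) := fun z ↦
  (differentiableAt_inverse (𝕜 := ℂ) (h z)).comp z
    (((differentiableAt_id.smul_const b).const_add a).const_sub 1)

/-- Linear systems `Y' = (A₀(x) + λ A₁(x)) Y` with integrable coefficients have solutions which are
entire in `λ`: the solution is `(1 - V₀ - λ V₁)⁻¹` applied to the constant initial value, and
inversion is analytic on the units. -/
theorem exists_entire_solution (hb : 0 ≤ b) {A₀ A₁ : ℝ → E →L[ℂ] E}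
    (h₀ : IntervalIntegrable A₀ volume 0 b) (h₁ : IntervalIntegrable A₁ volume 0 b) (v : E) :
    ∃ Y : ℂ → ℝ → E, (∀ lam, Continuous (Y lam)) ∧ (∀ x, Differentiable ℂ fun lam ↦ Y lam x) ∧
      ∀ lam, ∀ x ∈ Icc 0 b, Y lam x = v + ∫ t in (0 : ℝ)..x, (A₀ t + lam • A₁ t) (Y lam t) := by
  have hA : ∀ lam : ℂ, IntervalIntegrable (fun t ↦ A₀ t + lam • A₁ t) volume 0 b := fun lam ↦
    h₀.add (h₁.smul lam)
  have hV : ∀ lam : ℂ, volterra hb _ (hA lam) = volterra hb A₀ h₀ + lam • volterra hb A₁ h₁ := by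
    intro lam
    ext Y x
    have hx : uIcc 0 (x : ℝ) ⊆ uIcc 0 b := by
      rw [uIcc_of_le hb, uIcc_of_le x.2.1]; exact Icc_subset_Icc_right x.2.2
    have hY := Y.continuous.Icc_extend' (h := hb)
    simp only [add_apply, ContinuousMap.add_apply,
      smul_apply, ContinuousMap.smul_apply, volterra_apply]
    rw [← intervalIntegral.integral_smul]
    exact intervalIntegral.integral_add
      (intervalIntegrable_clm_apply (h₀.mono_set hx) hY)
      ((intervalIntegrable_clm_apply (h₁.mono_set hx) hY).smul lam)
  set T : ℂ → (C(Icc (0 : ℝ) b, E) →L[ℂ] C(Icc (0 : ℝ) b, E)) := fun lam ↦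
    1 - (volterra hb A₀ h₀ + lam • volterra hb A₁ h₁) with hT
  have hu : ∀ lam, IsUnit (T lam) := fun lam ↦ by
    simpa only [hT, hV] using isUnit_one_sub_volterra hb (hA lam)
  set c : C(Icc (0 : ℝ) b, E) := ContinuousMap.const _ v
  have hd : Differentiable ℂ fun lam ↦ Ring.inverse (T lam) :=
    differentiable_inverse_one_sub_add_smul
      (R := C(Icc (0 : ℝ) b, E) →L[ℂ] C(Icc (0 : ℝ) b, E))
      (volterra hb A₀ h₀) (volterra hb A₁ h₁) hu
  refine ⟨fun lam ↦ IccExtend hb (Ring.inverse (T lam) c), fun lam ↦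
    (Ring.inverse (T lam) c).continuous.Icc_extend' (h := hb), fun x ↦ ?_, fun lam x hx ↦ ?_⟩
  · have h1 : Differentiable ℂ fun lam ↦ Ring.inverse (T lam) c := hd.clm_apply
      (differentiable_const c)
    exact (ContinuousMap.evalCLM ℂ (projIcc 0 b hb x) :
      C(Icc (0 : ℝ) b, E) →L[ℂ] E).differentiable.comp h1
  · have h1 : T lam (Ring.inverse (T lam) c) = c := by
      have := Ring.mul_inverse_cancel _ (hu lam)
      calc _ = (T lam * Ring.inverse (T lam)) c := rfl
        _ = c := by rw [this]; rfl
    have h2 := DFunLike.congr_fun h1 (⟨x, hx⟩ : Icc (0 : ℝ) b)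
    simp only [hT] at h2
    rw [← hV, sub_apply, ContinuousMap.sub_apply, volterra_apply] at h2
    beta_reduce
    rw [IccExtend_of_mem hb _ hx]
    simp only [hT, ← hV]
    exact sub_eq_iff_eq_add.1 h2

end Volterra

/-! ### Quasi-solutions -/

section SquareIntegrable

variable {σ : ℝ → ℂ}

theorem intervalIntegrable_of_memLp_two
    (hσ : MemLp σ 2 (volume.restrict (Ioo (0 : ℝ) Real.pi))) :
    IntervalIntegrable σ volume 0 Real.pi :=
  (intervalIntegrable_iff_integrableOn_Ioo_of_le Real.pi_pos.le).2
    (hσ.integrable one_le_two)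

theorem intervalIntegrable_sq_of_memLp_two
    (hσ : MemLp σ 2 (volume.restrict (Ioo (0 : ℝ) Real.pi))) :
    IntervalIntegrable (fun t ↦ σ t ^ 2) volume 0 Real.pi := by
  refine (intervalIntegrable_iff_integrableOn_Ioo_of_le Real.pi_pos.le).2 ?_
  simpa only [sq] using! hσ.integrable_mul hσ

theorem MeasureTheory.MemLp.neg_reflect
    (hσ : MemLp σ 2 (volume.restrict (Ioo (0 : ℝ) Real.pi))) :
    MemLp (fun x ↦ -σ (Real.pi - x)) 2 (volume.restrict (Ioo (0 : ℝ) Real.pi)) := by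
  have h1 : MeasurePreserving (fun x : ℝ ↦ Real.pi - x) (volume.restrict (Ioo (0 : ℝ) Real.pi))
      (volume.restrict (Ioo (0 : ℝ) Real.pi)) := by
    have := (Measure.measurePreserving_sub_left volume Real.pi).restrict_preimage
      (measurableSet_Ioo (a := (0 : ℝ)) (b := Real.pi))
    simpa using this
  exact (hσ.comp_measurePreserving h1).neg

end SquareIntegrable

theorem absolutelyContinuous_and_hasDerivAt_of_integral {f g : ℝ → ℂ} {b : ℝ} (hb : 0 ≤ b)
    (hg : IntervalIntegrable g volume 0 b)
    (h : ∀ x ∈ Icc 0 b, f x = f 0 + ∫ t in (0 : ℝ)..x, g t) :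
    AbsolutelyContinuousOnInterval f 0 b ∧
      ∀ᵐ x ∂volume.restrict (Ioo 0 b), HasDerivAt f (g x) x := by
  constructor
  · have h1 : AbsolutelyContinuousOnInterval (fun x ↦ f 0 + ∫ t in (0 : ℝ)..x, g t) 0 b :=
      (contDiff_const (c := f 0)).contDiffOn.absolutelyContinuousOnInterval.fun_add
        (absolutelyContinuousOnInterval_integral hg)
    exact h1.congr fun x hx ↦ (h x (uIcc_of_le hb ▸ hx)).symm
  · rw [ae_restrict_iff' measurableSet_Ioo]
    filter_upwards [hg.ae_hasDerivAt_integral] with x hx hx'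
    rw [uIcc_of_le hb] at hx
    refine ((hx (Ioo_subset_Icc_self hx') 0 ⟨le_rfl, hb⟩).const_add (f 0)).congr_of_eventuallyEq ?_
    filter_upwards [Icc_mem_nhds hx'.1 hx'.2] with t ht using h t ht

namespace IsQuasiSolution

variable {σ : ℝ → ℂ} {lam : ℂ} {y y₁ z z₁ : ℝ → ℂ}

theorem continuousOn (h : IsQuasiSolution σ lam y y₁) : ContinuousOn y (Icc 0 Real.pi) := by
  simpa only [uIcc_of_le Real.pi_pos.le] using h.absolutelyContinuous.continuousOn

theorem continuousOn_quasi (h : IsQuasiSolution σ lam y y₁) :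
    ContinuousOn y₁ (Icc 0 Real.pi) := by
  simpa only [uIcc_of_le Real.pi_pos.le] using h.absolutelyContinuous_quasi.continuousOn

theorem intervalIntegrable_deriv (hσ : MemLp σ 2 (volume.restrict (Ioo (0 : ℝ) Real.pi)))
    (hy : ContinuousOn y (Icc 0 Real.pi)) (hy₁ : ContinuousOn y₁ (Icc 0 Real.pi)) :
    IntervalIntegrable (fun x ↦ y₁ x + σ x * y x) volume 0 Real.pi := by
  rw [← uIcc_of_le Real.pi_pos.le] at hy hy₁
  exact hy₁.intervalIntegrable.add ((intervalIntegrable_of_memLp_two hσ).mul_continuousOn hy)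

theorem intervalIntegrable_deriv_quasi (hσ : MemLp σ 2 (volume.restrict (Ioo (0 : ℝ) Real.pi)))
    (hy : ContinuousOn y (Icc 0 Real.pi)) (hy₁ : ContinuousOn y₁ (Icc 0 Real.pi)) (lam : ℂ) :
    IntervalIntegrable (fun x ↦ -(σ x * y₁ x) - σ x ^ 2 * y x - lam * y x) volume 0 Real.pi := by
  rw [← uIcc_of_le Real.pi_pos.le] at hy hy₁
  exact (((intervalIntegrable_of_memLp_two hσ).mul_continuousOn hy₁).neg.sub
    ((intervalIntegrable_sq_of_memLp_two hσ).mul_continuousOn hy)).sub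
    (hy.const_mul lam).intervalIntegrable

theorem eq_add_integral (hσ : MemLp σ 2 (volume.restrict (Ioo (0 : ℝ) Real.pi)))
    (h : IsQuasiSolution σ lam y y₁) {x : ℝ} (hx : x ∈ Icc 0 Real.pi) :
    y x = y 0 + ∫ t in (0 : ℝ)..x, (y₁ t + σ t * y t) :=
  h.absolutelyContinuous.eq_add_integral Real.pi_pos.le
    (intervalIntegrable_deriv hσ h.continuousOn h.continuousOn_quasi) h.hasDerivAt hx

theorem quasi_eq_add_integral (hσ : MemLp σ 2 (volume.restrict (Ioo (0 : ℝ) Real.pi)))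
    (h : IsQuasiSolution σ lam y y₁) {x : ℝ} (hx : x ∈ Icc 0 Real.pi) :
    y₁ x = y₁ 0 + ∫ t in (0 : ℝ)..x, (-(σ t * y₁ t) - σ t ^ 2 * y t - lam * y t) :=
  h.absolutelyContinuous_quasi.eq_add_integral Real.pi_pos.le
    (intervalIntegrable_deriv_quasi hσ h.continuousOn h.continuousOn_quasi lam)
    h.hasDerivAt_quasi hx

/-- Continuous solutions of the integrated system are quasi-solutions. -/
theorem of_integral (hσ : MemLp σ 2 (volume.restrict (Ioo (0 : ℝ) Real.pi)))
    (hy : ContinuousOn y (Icc 0 Real.pi)) (hy₁ : ContinuousOn y₁ (Icc 0 Real.pi))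
    (h : ∀ x ∈ Icc 0 Real.pi, y x = y 0 + ∫ t in (0 : ℝ)..x, (y₁ t + σ t * y t))
    (h₁ : ∀ x ∈ Icc 0 Real.pi,
      y₁ x = y₁ 0 + ∫ t in (0 : ℝ)..x, (-(σ t * y₁ t) - σ t ^ 2 * y t - lam * y t)) :
    IsQuasiSolution σ lam y y₁ := by
  have k := absolutelyContinuous_and_hasDerivAt_of_integral Real.pi_pos.le
    (intervalIntegrable_deriv hσ hy hy₁) h
  have k₁ := absolutelyContinuous_and_hasDerivAt_of_integral Real.pi_pos.le
    (intervalIntegrable_deriv_quasi hσ hy hy₁ lam) h₁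
  exact ⟨k.1, k₁.1, k.2, k₁.2⟩

theorem linear_combination (hy : IsQuasiSolution σ lam y y₁) (hz : IsQuasiSolution σ lam z z₁)
    (a b : ℂ) :
    IsQuasiSolution σ lam (fun x ↦ a * y x + b * z x) (fun x ↦ a * y₁ x + b * z₁ x) := by
  refine ⟨(hy.1.const_smul a).fun_add (hz.1.const_smul b),
    (hy.2.const_smul a).fun_add (hz.2.const_smul b), ?_, ?_⟩
  · filter_upwards [hy.3, hz.3] with x h1 h2
    convert! (h1.const_mul a).add (h2.const_mul b) using 1
    ring
  · filter_upwards [hy.4, hz.4] with x h1 h2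
    convert! (h1.const_mul a).add (h2.const_mul b) using 1
    ring

/-- The Wronskian of two solutions of the same equation is constant. -/
theorem wronskian_eq (hy : IsQuasiSolution σ lam y y₁) (hz : IsQuasiSolution σ lam z z₁)
    {x : ℝ} (hx : x ∈ Icc 0 Real.pi) :
    y x * z₁ x - z x * y₁ x = y 0 * z₁ 0 - z 0 * y₁ 0 := by
  refine AbsolutelyContinuousOnInterval.eq_left_of_ae_hasDerivAt_zero
    (f := fun x ↦ y x * z₁ x - z x * y₁ x) Real.pi_pos.le
    ((hy.1.fun_smul hz.2).fun_sub (hz.1.fun_smul hy.2)) ?_ hx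
  filter_upwards [hy.3, hz.3, hy.4, hz.4] with x h1 h2 h3 h4
  convert! (h1.mul h4).sub (h2.mul h3) using 1
  ring

/-- The reflection `x ↦ π - x` turns solutions into solutions, with `σ` and the quasi-derivative
changing sign. -/
theorem reflect (hσ : MemLp σ 2 (volume.restrict (Ioo (0 : ℝ) Real.pi)))
    (h : IsQuasiSolution σ lam y y₁) :
    IsQuasiSolution (fun x ↦ -σ (Real.pi - x)) lam (fun x ↦ y (Real.pi - x))
      (fun x ↦ -y₁ (Real.pi - x)) := by
  have hm : MapsTo (fun x : ℝ ↦ Real.pi - x) (Icc 0 Real.pi) (Icc 0 Real.pi) := fun x hx ↦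
    ⟨by linarith [hx.2], by linarith [hx.1]⟩
  have hc : ContinuousOn (fun x : ℝ ↦ Real.pi - x) (Icc 0 Real.pi) := by fun_prop
  have key : ∀ f g : ℝ → ℂ, IntervalIntegrable g volume 0 Real.pi →
      (∀ x ∈ Icc 0 Real.pi, f x = f 0 + ∫ t in (0 : ℝ)..x, g t) → ∀ x ∈ Icc 0 Real.pi,
      f (Real.pi - x) = f (Real.pi - 0) + ∫ t in (0 : ℝ)..x, -g (Real.pi - t) := by
    intro f g hg hf x hx
    have hs : ∀ z ∈ Icc 0 Real.pi, IntervalIntegrable g volume 0 z := fun z hz ↦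
      hg.mono_set (uIcc_subset_uIcc left_mem_uIcc (by rwa [uIcc_of_le Real.pi_pos.le]))
    have hpi : Real.pi ∈ Icc 0 Real.pi := ⟨Real.pi_pos.le, le_rfl⟩
    rw [intervalIntegral.integral_neg, intervalIntegral.integral_comp_sub_left, sub_zero,
      ← intervalIntegral.integral_interval_sub_left (hs _ hpi) (hs _ (hm hx)),
      hf _ (hm hx), hf _ hpi]
    ring
  refine of_integral hσ.neg_reflect (h.continuousOn.comp hc hm)
    (h.continuousOn_quasi.comp hc hm).neg (fun x hx ↦ ?_) (fun x hx ↦ ?_)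
  · rw [key y _ (intervalIntegrable_deriv hσ h.continuousOn h.continuousOn_quasi)
      (fun x hx ↦ h.eq_add_integral hσ hx) x hx]
    congr 2; ext t; ring
  · rw [key y₁ _ (intervalIntegrable_deriv_quasi hσ h.continuousOn h.continuousOn_quasi lam)
      (fun x hx ↦ h.quasi_eq_add_integral hσ hx) x hx, neg_add, ← intervalIntegral.integral_neg]
    congr 2; ext t; ring

end IsQuasiSolution

/-- For every initial value at `0` there is a family of solutions, entire in the spectral
parameter. -/
theorem exists_isQuasiSolution_entire {σ : ℝ → ℂ}
    (hσ : MemLp σ 2 (volume.restrict (Ioo (0 : ℝ) Real.pi))) (c d : ℂ) :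
    ∃ y y₁ : ℂ → ℝ → ℂ, (∀ lam, IsQuasiSolution σ lam (y lam) (y₁ lam)) ∧
      (∀ lam, y lam 0 = c) ∧ (∀ lam, y₁ lam 0 = d) ∧ ∀ x, Differentiable ℂ fun lam ↦ y lam x := by
  set fst := ContinuousLinearMap.fst ℂ ℂ ℂ
  set snd := ContinuousLinearMap.snd ℂ ℂ ℂ
  set P : ℂ × ℂ →L[ℂ] ℂ × ℂ := fst.prod (-snd) with hP
  set Q : ℂ × ℂ →L[ℂ] ℂ × ℂ := (0 : ℂ × ℂ →L[ℂ] ℂ).prod (-fst) with hQ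
  set R : ℂ × ℂ →L[ℂ] ℂ × ℂ := snd.prod 0 with hR
  have hsm : ∀ f : ℝ → ℂ, IntervalIntegrable f volume 0 Real.pi → ∀ L : ℂ × ℂ →L[ℂ] ℂ × ℂ,
      IntervalIntegrable (fun t ↦ f t • L) volume 0 Real.pi := fun f hf L ↦
    ⟨hf.1.smul_const L, hf.2.smul_const L⟩
  have h₀ : IntervalIntegrable (fun t ↦ σ t • P + σ t ^ 2 • Q + R) volume 0 Real.pi :=
    ((hsm _ (intervalIntegrable_of_memLp_two hσ) P).add
      (hsm _ (intervalIntegrable_sq_of_memLp_two hσ) Q)).add intervalIntegrable_const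
  have h₁ : IntervalIntegrable (fun _ : ℝ ↦ Q) volume 0 Real.pi := intervalIntegrable_const
  obtain ⟨Y, hc, hd, hY⟩ := exists_entire_solution Real.pi_pos.le h₀ h₁ (c, d)
  have h0 : ∀ lam, Y lam 0 = (c, d) := fun lam ↦ by
    simpa using hY lam 0 ⟨le_rfl, Real.pi_pos.le⟩
  have hI : ∀ lam, ∀ x ∈ Icc 0 Real.pi, IntervalIntegrable
      (fun t ↦ (σ t • P + σ t ^ 2 • Q + R + lam • Q) (Y lam t)) volume 0 x := fun lam x hx ↦
    (intervalIntegrable_clm_apply (h₀.add (h₁.smul lam)) (hc lam)).mono_set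
      (uIcc_subset_uIcc left_mem_uIcc (by rwa [uIcc_of_le Real.pi_pos.le]))
  refine ⟨fun lam x ↦ (Y lam x).1, fun lam x ↦ (Y lam x).2, fun lam ↦ ?_, fun lam ↦ by simp [h0],
    fun lam ↦ by simp [h0], fun x ↦ fst.differentiable.comp (hd x)⟩
  refine IsQuasiSolution.of_integral hσ (hc lam).fst.continuousOn (hc lam).snd.continuousOn
    (fun x hx ↦ ?_) (fun x hx ↦ ?_)
  · beta_reduce
    rw [h0, hY lam x hx]
    refine congrArg (c + ·) ?_
    refine (fst.intervalIntegral_comp_comm (hI lam x hx)).symm.trans ?_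
    congr 1; ext t
    simp [fst, snd, hP, hQ, hR]
    ring
  · beta_reduce
    rw [h0, hY lam x hx]
    refine congrArg (d + ·) ?_
    refine (snd.intervalIntegral_comp_comm (hI lam x hx)).symm.trans ?_
    congr 1; ext t
    simp [fst, snd, hP, hQ, hR]
    ring

/-! ### Weighted integrals of a square integrable function -/

section WeightedIntegrals

variable {σ : ℝ → ℂ}

theorem intervalIntegrable_norm_sq_of_memLp_two
    (hσ : MemLp σ 2 (volume.restrict (Ioo (0 : ℝ) Real.pi))) :
    IntervalIntegrable (fun t ↦ ‖σ t‖ ^ 2) volume 0 Real.pi := by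
  simpa only [norm_pow] using (intervalIntegrable_sq_of_memLp_two hσ).norm

theorem IntervalIntegrable.mono_right {E : Type*} [NormedAddCommGroup E] {f : ℝ → E} {b x : ℝ}
    (h : IntervalIntegrable f volume 0 b) (hx : x ∈ Icc 0 b) : IntervalIntegrable f volume 0 x :=
  h.mono_set (uIcc_subset_uIcc left_mem_uIcc (Icc_subset_uIcc hx))

/-- A Cauchy–Schwarz type bound: a weight with small `L²` norm makes the integral of `‖σ‖` small. -/
theorem integral_weight_mul_norm_le (hσ : MemLp σ 2 (volume.restrict (Ioo (0 : ℝ) Real.pi)))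
    {L : ℝ} (hL : 0 < L) {x : ℝ} (hx : x ∈ Icc 0 Real.pi) {w : ℝ → ℝ} (hw : Continuous w)
    (hwL : ∫ t in (0 : ℝ)..x, w t ^ 2 ≤ 1 / L) :
    ∫ t in (0 : ℝ)..x, w t * ‖σ t‖ ≤ ((∫ t in (0 : ℝ)..Real.pi, ‖σ t‖ ^ 2) + 1) / √L := by
  have hs : 0 < √L := Real.sqrt_pos.2 hL
  have h1 := (intervalIntegrable_of_memLp_two hσ).norm.mono_right hx
  have h2 := (intervalIntegrable_norm_sq_of_memLp_two hσ).mono_right hx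
  have hw2 : IntervalIntegrable (fun t ↦ w t ^ 2) volume 0 x := (hw.pow 2).intervalIntegrable _ _
  have h3 : ∫ t in (0 : ℝ)..x, w t * ‖σ t‖ ≤
      ∫ t in (0 : ℝ)..x, ((√L)⁻¹ * ‖σ t‖ ^ 2 + √L * w t ^ 2) := by
    refine intervalIntegral.integral_mono_on hx.1 (h1.continuousOn_mul hw.continuousOn)
      ((h2.const_mul _).add (hw2.const_mul _)) fun t _ ↦ ?_
    have h4 : 0 ≤ (√L)⁻¹ * (‖σ t‖ - √L * w t / 2) ^ 2 := by positivity
    have h5 : (√L)⁻¹ * (‖σ t‖ - √L * w t / 2) ^ 2 =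
        (√L)⁻¹ * ‖σ t‖ ^ 2 + √L * w t ^ 2 / 4 - w t * ‖σ t‖ := by field_simp; ring
    nlinarith [mul_nonneg hs.le (sq_nonneg (w t))]
  have h6 : ∫ t in (0 : ℝ)..x, ‖σ t‖ ^ 2 ≤ ∫ t in (0 : ℝ)..Real.pi, ‖σ t‖ ^ 2 :=
    intervalIntegral.integral_mono_interval le_rfl hx.1 hx.2 (ae_of_all _ fun _ ↦ by positivity)
      (intervalIntegrable_norm_sq_of_memLp_two hσ)
  rw [intervalIntegral.integral_add (h2.const_mul _) (hw2.const_mul _),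
    intervalIntegral.integral_const_mul, intervalIntegral.integral_const_mul] at h3
  have h7 : √L * (1 / L) = (√L)⁻¹ := by
    nth_rw 2 [← Real.mul_self_sqrt hL.le]; field_simp
  calc _ ≤ _ := h3
    _ ≤ (√L)⁻¹ * (∫ t in (0 : ℝ)..Real.pi, ‖σ t‖ ^ 2) + √L * (1 / L) := by gcongr
    _ = _ := by rw [h7]; ring

theorem integral_exp_mul_le {L : ℝ} (hL : 0 < L) (c x : ℝ) :
    ∫ t in (0 : ℝ)..x, Real.exp (L * t - c) ≤ Real.exp (L * x - c) / L := by
  have h : ∫ t in (0 : ℝ)..x, Real.exp (L * t - c) =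
      Real.exp (L * x - c) / L - Real.exp (L * 0 - c) / L := by
    refine intervalIntegral.integral_eq_sub_of_hasDerivAt (f := fun t ↦ Real.exp (L * t - c) / L)
      (fun t _ ↦ ?_) (Continuous.intervalIntegrable (by fun_prop) _ _)
    convert! ((((hasDerivAt_id t).const_mul L).sub_const c).exp.div_const L) using 1
    simp only [id]; field_simp
  rw [h]
  have : 0 ≤ Real.exp (L * 0 - c) / L := by positivity
  linarith

theorem integral_exp_sub_mul_norm_le
    (hσ : MemLp σ 2 (volume.restrict (Ioo (0 : ℝ) Real.pi)))
    {L : ℝ} (hL : 0 < L) {x : ℝ} (hx : x ∈ Icc 0 Real.pi) :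
    ∫ t in (0 : ℝ)..x, Real.exp (L * t - L * x) * ‖σ t‖ ≤
      ((∫ t in (0 : ℝ)..Real.pi, ‖σ t‖ ^ 2) + 1) / √L := by
  refine integral_weight_mul_norm_le hσ hL hx (by fun_prop) ?_
  have h := integral_exp_mul_le (show 0 < 2 * L by positivity) (2 * L * x) x
  rw [sub_self, Real.exp_zero] at h
  calc _ = ∫ t in (0 : ℝ)..x, Real.exp (2 * L * t - 2 * L * x) := by
        congr 1; ext t; rw [sq, ← Real.exp_add]; ring_nf
    _ ≤ _ := h
    _ ≤ 1 / L := by gcongr; linarith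

theorem integral_exp_neg_mul_norm_le
    (hσ : MemLp σ 2 (volume.restrict (Ioo (0 : ℝ) Real.pi)))
    {L : ℝ} (hL : 0 < L) {x : ℝ} (hx : x ∈ Icc 0 Real.pi) :
    ∫ t in (0 : ℝ)..x, Real.exp (-(L * t)) * ‖σ t‖ ≤
      ((∫ t in (0 : ℝ)..Real.pi, ‖σ t‖ ^ 2) + 1) / √L := by
  refine integral_weight_mul_norm_le hσ hL hx (by fun_prop) ?_
  have h := integral_exp_mul_le (show 0 < 2 * L by positivity) (2 * L * x) x
  rw [sub_self, Real.exp_zero] at h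
  have hr := intervalIntegral.integral_comp_sub_left (a := 0) (b := x)
    (fun t ↦ Real.exp (2 * L * t - 2 * L * x)) x
  rw [sub_self, sub_zero] at hr
  calc _ = ∫ t in (0 : ℝ)..x, Real.exp (2 * L * (x - t) - 2 * L * x) := by
        congr 1; ext t; rw [sq, ← Real.exp_add]; ring_nf
    _ ≤ 1 / (2 * L) := hr.trans_le h
    _ ≤ 1 / L := by gcongr; linarith

/-- The weighted kernel estimate behind all bounds on solutions. -/
theorem integral_exp_sub_mul_le
    (hσ : MemLp σ 2 (volume.restrict (Ioo (0 : ℝ) Real.pi)))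
    {L : ℝ} (hL : 0 < L) {α β : ℝ} (hα : 0 ≤ α) (hβ : 0 ≤ β) {x : ℝ} (hx : x ∈ Icc 0 Real.pi) :
    IntervalIntegrable (fun t ↦ Real.exp (L * t - L * x) * (α + ‖σ t‖ + β * ‖σ t‖ ^ 2)) volume 0 x ∧
    ∫ t in (0 : ℝ)..x, Real.exp (L * t - L * x) * (α + ‖σ t‖ + β * ‖σ t‖ ^ 2) ≤
      α / L + ((∫ t in (0 : ℝ)..Real.pi, ‖σ t‖ ^ 2) + 1) / √L +
        β * ∫ t in (0 : ℝ)..Real.pi, ‖σ t‖ ^ 2 := by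
  have h1 := (intervalIntegrable_of_memLp_two hσ).norm.mono_right hx
  have h2 := (intervalIntegrable_norm_sq_of_memLp_two hσ).mono_right hx
  have he : Continuous fun t ↦ Real.exp (L * t - L * x) := by fun_prop
  have i0 : IntervalIntegrable (fun t ↦ α * Real.exp (L * t - L * x)) volume 0 x :=
    (he.const_mul α).intervalIntegrable _ _
  have i1 : IntervalIntegrable (fun t ↦ Real.exp (L * t - L * x) * ‖σ t‖) volume 0 x :=
    h1.continuousOn_mul he.continuousOn
  have i2 : IntervalIntegrable (fun t ↦ Real.exp (L * t - L * x) * (β * ‖σ t‖ ^ 2)) volume 0 x :=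
    (h2.const_mul β).continuousOn_mul he.continuousOn
  have heq : (fun t ↦ Real.exp (L * t - L * x) * (α + ‖σ t‖ + β * ‖σ t‖ ^ 2)) = fun t ↦
      α * Real.exp (L * t - L * x) + Real.exp (L * t - L * x) * ‖σ t‖ +
        Real.exp (L * t - L * x) * (β * ‖σ t‖ ^ 2) := by ext t; ring
  rw [heq]
  refine ⟨(i0.add i1).add i2, ?_⟩
  rw [intervalIntegral.integral_add (i0.add i1) i2, intervalIntegral.integral_add i0 i1]
  gcongr ?_ + ?_ + ?_
  · rw [intervalIntegral.integral_const_mul]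
    have := integral_exp_mul_le hL (L * x) x
    rw [sub_self, Real.exp_zero] at this
    calc _ ≤ α * (1 / L) := by gcongr
      _ = _ := by ring
  · exact integral_exp_sub_mul_norm_le hσ hL hx
  · calc _ ≤ ∫ t in (0 : ℝ)..x, β * ‖σ t‖ ^ 2 := by
          refine intervalIntegral.integral_mono_on hx.1 i2 (h2.const_mul β) fun t ht ↦ ?_
          have : Real.exp (L * t - L * x) ≤ 1 := by
            rw [Real.exp_le_one_iff]; nlinarith [ht.2]
          exact mul_le_of_le_one_left (by positivity) this
      _ = β * ∫ t in (0 : ℝ)..x, ‖σ t‖ ^ 2 := intervalIntegral.integral_const_mul _ _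
      _ ≤ _ := by
          gcongr
          exact intervalIntegral.integral_mono_interval le_rfl hx.1 hx.2
            (ae_of_all _ fun _ ↦ by positivity) (intervalIntegrable_norm_sq_of_memLp_two hσ)

end WeightedIntegrals

/-! ### Growth of solutions in the spectral parameter -/

namespace IsQuasiSolution

variable {σ : ℝ → ℂ}

/-- Solutions grow at most like `exp (4 π |κ|)`, where `lam = -κ²`: this is what makes them entire
functions of order `1 / 2` in `lam`. -/
theorem exists_norm_le_exp (hσ : MemLp σ 2 (volume.restrict (Ioo (0 : ℝ) Real.pi))) :
    ∃ K : ℝ, 1 ≤ K ∧ ∀ (κ : ℂ) (y y₁ : ℝ → ℂ), K ≤ ‖κ‖ → IsQuasiSolution σ (-κ ^ 2) y y₁ →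
      ∀ x ∈ Icc 0 Real.pi,
        ‖κ‖ * ‖y x‖ ≤ 2 * (‖κ‖ * ‖y 0‖ + ‖y₁ 0‖) * Real.exp (4 * ‖κ‖ * Real.pi) := by
  set G := ∫ t in (0 : ℝ)..Real.pi, ‖σ t‖ ^ 2 with hG
  have hG0 : 0 ≤ G := intervalIntegral.integral_nonneg Real.pi_pos.le fun _ _ ↦ by positivity
  refine ⟨16 * (G + 1) ^ 2, by nlinarith, fun κ y y₁ hκ h x hx ↦ ?_⟩
  have hκ0 : 0 < ‖κ‖ := lt_of_lt_of_le (by positivity) hκ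
  set L := 4 * ‖κ‖ with hL
  have hL0 : 0 < L := by positivity
  -- the weighted norm of the solution, which attains its maximum
  set f : ℝ → ℝ := fun x ↦ Real.exp (-(L * x)) * (‖κ‖ * ‖y x‖ + ‖y₁ x‖) with hf
  have hfc : ContinuousOn f (Icc 0 Real.pi) := by
    have h1 := h.continuousOn.norm
    have h2 := h.continuousOn_quasi.norm
    exact ContinuousOn.mul (by fun_prop) ((h1.const_mul _).add h2)
  obtain ⟨s, hs, hmax⟩ := isCompact_Icc.exists_isMaxOn (nonempty_Icc.2 Real.pi_pos.le) hfc
  set M := f s with hM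
  have hM0 : 0 ≤ M := by simp only [hM, hf]; positivity
  have hfM : ∀ t ∈ Icc 0 Real.pi, ‖κ‖ * ‖y t‖ + ‖y₁ t‖ ≤ M * Real.exp (L * t) := fun t ht ↦ by
    have h1 : f t ≤ M := hmax ht
    calc _ = f t * Real.exp (L * t) := by
          simp only [hf]
          rw [mul_right_comm, ← Real.exp_add, neg_add_cancel, Real.exp_zero, one_mul]
      _ ≤ _ := by gcongr
  obtain ⟨hint, hle⟩ := integral_exp_sub_mul_le hσ hL0 hκ0.le (inv_nonneg.2 hκ0.le) hs
  rw [← hG] at hle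
  set D : ℝ → ℝ := fun t ↦ Real.exp (L * t - L * s) * (‖κ‖ + ‖σ t‖ + ‖κ‖⁻¹ * ‖σ t‖ ^ 2) with hD
  have i1 := (intervalIntegrable_deriv hσ h.continuousOn h.continuousOn_quasi).mono_right hs
  have i2 := (intervalIntegrable_deriv_quasi hσ h.continuousOn h.continuousOn_quasi
    (-κ ^ 2)).mono_right hs
  have hsmall : ‖κ‖ / L + (G + 1) / √L + ‖κ‖⁻¹ * G ≤ 1 / 2 := by
    have h1 : ‖κ‖ / L = 1 / 4 := by rw [hL]; field_simp
    have h2 : 8 * (G + 1) ≤ √L := by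
      refine Real.le_sqrt_of_sq_le ?_
      nlinarith
    have h3 : (G + 1) / √L ≤ 1 / 8 := by
      rw [div_le_iff₀ (Real.sqrt_pos.2 hL0)]; linarith
    have h4 : ‖κ‖⁻¹ * G ≤ 1 / 8 := by
      rw [inv_mul_le_iff₀ hκ0]; nlinarith
    linarith
  have hM2 : M ≤ (‖κ‖ * ‖y 0‖ + ‖y₁ 0‖) + M * (1 / 2) := by
    have e1 : ‖κ‖ * ‖y s‖ ≤ ‖κ‖ * ‖y 0‖ + ∫ t in (0 : ℝ)..s, ‖κ‖ * ‖y₁ t + σ t * y t‖ := by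
      rw [h.eq_add_integral hσ hs, intervalIntegral.integral_const_mul, ← mul_add]
      gcongr
      exact (norm_add_le _ _).trans
        (add_le_add_right (intervalIntegral.norm_integral_le_integral_norm hs.1) _)
    have e2 : ‖y₁ s‖ ≤ ‖y₁ 0‖ +
        ∫ t in (0 : ℝ)..s, ‖-(σ t * y₁ t) - σ t ^ 2 * y t - (-κ ^ 2) * y t‖ := by
      rw [h.quasi_eq_add_integral hσ hs]
      exact (norm_add_le _ _).trans
        (add_le_add_right (intervalIntegral.norm_integral_le_integral_norm hs.1) _)
    have e3 : (∫ t in (0 : ℝ)..s, ‖κ‖ * ‖y₁ t + σ t * y t‖) +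
        (∫ t in (0 : ℝ)..s, ‖-(σ t * y₁ t) - σ t ^ 2 * y t - (-κ ^ 2) * y t‖) ≤
        ∫ t in (0 : ℝ)..s, M * Real.exp (L * s) * D t := by
      rw [← intervalIntegral.integral_add (i1.norm.const_mul _) i2.norm]
      refine intervalIntegral.integral_mono_on hs.1 ((i1.norm.const_mul _).add i2.norm)
        (hint.const_mul _) fun t ht ↦ ?_
      have n1 : ‖y₁ t + σ t * y t‖ ≤ ‖y₁ t‖ + ‖σ t‖ * ‖y t‖ := by
        simpa only [norm_mul] using norm_add_le (y₁ t) (σ t * y t)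
      have n2 : ‖-(σ t * y₁ t) - σ t ^ 2 * y t - (-κ ^ 2) * y t‖ ≤
          ‖σ t‖ * ‖y₁ t‖ + ‖σ t‖ ^ 2 * ‖y t‖ + ‖κ‖ ^ 2 * ‖y t‖ := by
        refine (norm_sub_le _ _).trans (add_le_add ((norm_sub_le _ _).trans (le_of_eq ?_))
          (le_of_eq ?_)) <;> simp
      have n3 := hfM t ⟨ht.1, ht.2.trans hs.2⟩
      have n4 : M * Real.exp (L * s) * D t =
          (‖κ‖ + ‖σ t‖ + ‖κ‖⁻¹ * ‖σ t‖ ^ 2) * (M * Real.exp (L * t)) := by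
        simp only [hD]
        rw [show L * t = L * s + (L * t - L * s) by ring, Real.exp_add,
          show L * s + (L * t - L * s) - L * s = L * t - L * s by ring]
        ring
      rw [n4]
      calc _ ≤ ‖κ‖ * (‖y₁ t‖ + ‖σ t‖ * ‖y t‖) +
            (‖σ t‖ * ‖y₁ t‖ + ‖σ t‖ ^ 2 * ‖y t‖ + ‖κ‖ ^ 2 * ‖y t‖) := by gcongr
        _ = (‖κ‖ + ‖σ t‖ + ‖κ‖⁻¹ * ‖σ t‖ ^ 2) * (‖κ‖ * ‖y t‖ + ‖y₁ t‖) -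
            ‖κ‖⁻¹ * ‖σ t‖ ^ 2 * ‖y₁ t‖ := by field_simp; ring
        _ ≤ (‖κ‖ + ‖σ t‖ + ‖κ‖⁻¹ * ‖σ t‖ ^ 2) * (‖κ‖ * ‖y t‖ + ‖y₁ t‖) :=
            sub_le_self _ (by positivity)
        _ ≤ _ := by gcongr
    rw [intervalIntegral.integral_const_mul (M * Real.exp (L * s))] at e3
    have e4 : ‖κ‖ * ‖y s‖ + ‖y₁ s‖ ≤ (‖κ‖ * ‖y 0‖ + ‖y₁ 0‖) +
        M * Real.exp (L * s) * (1 / 2) := by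
      have : M * Real.exp (L * s) * (∫ t in (0 : ℝ)..s, D t) ≤ M * Real.exp (L * s) * (1 / 2) := by
        gcongr; exact hle.trans hsmall
      linarith
    have e5 : Real.exp (-(L * s)) ≤ 1 := by
      rw [Real.exp_le_one_iff]; nlinarith [hs.1]
    calc M = Real.exp (-(L * s)) * (‖κ‖ * ‖y s‖ + ‖y₁ s‖) := rfl
      _ ≤ Real.exp (-(L * s)) * ((‖κ‖ * ‖y 0‖ + ‖y₁ 0‖) + M * Real.exp (L * s) * (1 / 2)) := by
          gcongr
      _ = Real.exp (-(L * s)) * (‖κ‖ * ‖y 0‖ + ‖y₁ 0‖) +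
          M * (Real.exp (-(L * s)) * Real.exp (L * s)) * (1 / 2) := by ring
      _ ≤ 1 * (‖κ‖ * ‖y 0‖ + ‖y₁ 0‖) + M * 1 * (1 / 2) := by
          rw [← Real.exp_add, neg_add_cancel, Real.exp_zero]; gcongr
      _ = _ := by ring
  calc ‖κ‖ * ‖y x‖ ≤ ‖κ‖ * ‖y x‖ + ‖y₁ x‖ := by linarith [norm_nonneg (y₁ x)]
    _ ≤ M * Real.exp (L * x) := hfM x hx
    _ ≤ 2 * (‖κ‖ * ‖y 0‖ + ‖y₁ 0‖) * Real.exp (L * Real.pi) := by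
        gcongr
        · linarith
        · exact hx.2

/-- Variation of constants for the growing mode `κ y + y^{[1]}`. -/
theorem exp_neg_mul_eq (hσ : MemLp σ 2 (volume.restrict (Ioo (0 : ℝ) Real.pi))) {κ : ℂ}
    {y y₁ : ℝ → ℂ} (h : IsQuasiSolution σ (-κ ^ 2) y y₁) {x : ℝ} (hx : x ∈ Icc 0 Real.pi) :
    IntervalIntegrable (fun t : ℝ ↦ Complex.exp (-κ * t) *
      (σ t * (κ * y t - y₁ t) - σ t ^ 2 * y t)) volume 0 x ∧
    Complex.exp (-κ * x) * (κ * y x + y₁ x) = (κ * y 0 + y₁ 0) + ∫ t in (0 : ℝ)..x,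
      Complex.exp (-κ * t) * (σ t * (κ * y t - y₁ t) - σ t ^ 2 * y t) := by
  have hcd : ContDiff ℝ 1 fun x : ℝ ↦ Complex.exp (-κ * x) :=
    (contDiff_const.mul Complex.ofRealCLM.contDiff).cexp
  have hy := h.absolutelyContinuous.continuousOn
  have hy₁ := h.absolutelyContinuous_quasi.continuousOn
  have hint : IntervalIntegrable (fun t : ℝ ↦ Complex.exp (-κ * t) *
      (σ t * (κ * y t - y₁ t) - σ t ^ 2 * y t)) volume 0 Real.pi :=
    (((intervalIntegrable_of_memLp_two hσ).mul_continuousOn ((hy.const_mul κ).sub hy₁)).sub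
      ((intervalIntegrable_sq_of_memLp_two hσ).mul_continuousOn hy)).continuousOn_mul
      hcd.continuous.continuousOn
  refine ⟨hint.mono_right hx, ?_⟩
  have := AbsolutelyContinuousOnInterval.eq_add_integral
    (f := fun x : ℝ ↦ Complex.exp (-κ * x) * (κ * y x + y₁ x)) Real.pi_pos.le
    (hcd.contDiffOn.absolutelyContinuousOnInterval.fun_smul
      ((h.absolutelyContinuous.const_smul κ).fun_add h.absolutelyContinuous_quasi)) hint (by
      filter_upwards [h.hasDerivAt, h.hasDerivAt_quasi] with t h1 h2
      convert! (((Complex.ofRealCLM.hasDerivAt (x := t)).const_mul (-κ)).cexp).mul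
        ((h1.const_mul κ).add h2) using 1
      simp only [Complex.ofRealCLM_apply, Pi.add_apply]
      push_cast
      ring) hx
  simpa using this

/-- Variation of constants for the decaying mode `κ y - y^{[1]}`. -/
theorem exp_mul_eq (hσ : MemLp σ 2 (volume.restrict (Ioo (0 : ℝ) Real.pi))) {κ : ℂ}
    {y y₁ : ℝ → ℂ} (h : IsQuasiSolution σ (-κ ^ 2) y y₁) {x : ℝ} (hx : x ∈ Icc 0 Real.pi) :
    IntervalIntegrable (fun t : ℝ ↦ Complex.exp (κ * t) *
      (σ t * (κ * y t + y₁ t) + σ t ^ 2 * y t)) volume 0 x ∧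
    Complex.exp (κ * x) * (κ * y x - y₁ x) = (κ * y 0 - y₁ 0) + ∫ t in (0 : ℝ)..x,
      Complex.exp (κ * t) * (σ t * (κ * y t + y₁ t) + σ t ^ 2 * y t) := by
  -- changing the sign of `κ` interchanges the two combinations
  obtain ⟨h1, h2⟩ := exp_neg_mul_eq (κ := -κ) hσ (by rwa [neg_sq]) hx
  have e : ∀ t : ℝ, Complex.exp (κ * t) * (σ t * (κ * y t + y₁ t) + σ t ^ 2 * y t) =
      -(Complex.exp (-(-κ) * t) * (σ t * (-κ * y t - y₁ t) - σ t ^ 2 * y t)) := fun t ↦ by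
    rw [neg_neg]; ring
  simp only [e]
  refine ⟨h1.neg, ?_⟩
  rw [intervalIntegral.integral_neg]
  simp only [neg_neg] at h2 ⊢
  linear_combination -h2

end IsQuasiSolution

/-! ### Growing and decaying modes -/

namespace IsQuasiSolution

variable {σ : ℝ → ℂ}

/-- Sectorial estimate. If the initial value is not almost purely the decaying mode `e^{-κ x}`,
then for large `κ` in the sector `‖κ‖ ≤ 2 re κ` the solution grows exactly like `e^{κ x}`. -/
theorem exists_sectorial_bounds (hσ : MemLp σ 2 (volume.restrict (Ioo (0 : ℝ) Real.pi))) :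
    ∃ K : ℝ, 1 ≤ K ∧ ∀ (κ : ℂ) (y y₁ : ℝ → ℂ), K ≤ ‖κ‖ → ‖κ‖ ≤ 2 * κ.re →
      IsQuasiSolution σ (-κ ^ 2) y y₁ → ‖κ * y 0 - y₁ 0‖ ≤ 2 * ‖κ * y 0 + y₁ 0‖ →
      (∀ x ∈ Icc 0 Real.pi, ‖κ‖ * ‖y x‖ ≤ 3 * ‖κ * y 0 + y₁ 0‖ * Real.exp (κ.re * x)) ∧
        ‖κ * y 0 + y₁ 0‖ * Real.exp (κ.re * Real.pi) ≤ 8 * ‖y₁ Real.pi‖ := by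
  set G := ∫ t in (0 : ℝ)..Real.pi, ‖σ t‖ ^ 2 with hG
  have hG0 : 0 ≤ G := intervalIntegral.integral_nonneg Real.pi_pos.le fun _ _ ↦ by positivity
  set N := ∫ t in (0 : ℝ)..Real.pi, ‖σ t‖ with hN
  have hN0 : 0 ≤ N := intervalIntegral.integral_nonneg Real.pi_pos.le fun _ _ ↦ by positivity
  refine ⟨(32 * (N + 1) * (G + 1)) ^ 2, by
    have : (1 : ℝ) ≤ 32 * (N + 1) * (G + 1) := by nlinarith [mul_nonneg hN0 hG0]
    nlinarith, fun κ y y₁ hκ hre h hini ↦ ?_⟩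
  have hR1 : (1 : ℝ) ≤ (N + 1) * (G + 1) := by nlinarith [mul_nonneg hN0 hG0]
  have hκ16 : 16 ≤ ‖κ‖ := le_trans (by nlinarith) hκ
  have hκ0 : 0 < ‖κ‖ := by linarith
  set k := κ.re with hk
  have hk0 : 0 < 2 * k := by linarith
  set P := ‖κ * y 0 + y₁ 0‖ with hP
  have hP0 : 0 ≤ P := norm_nonneg _
  set Q := ‖κ * y 0 - y₁ 0‖ with hQ
  set ε := (G + 1) / √(2 * k) + ‖κ‖⁻¹ * G with hε
  have hε0 : 0 ≤ ε := by positivity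
  have hsmall : (N + 1) * ε ≤ 1 / 16 := by
    have h2 : 32 * (N + 1) * (G + 1) ≤ √(2 * k) := Real.le_sqrt_of_sq_le (by linarith)
    have h3 : (N + 1) * ((G + 1) / √(2 * k)) ≤ 1 / 32 := by
      rw [← mul_div_assoc, div_le_iff₀ (Real.sqrt_pos.2 hk0)]; linarith
    have h4 : (N + 1) * (‖κ‖⁻¹ * G) ≤ 1 / 32 := by
      have : 32 * ((N + 1) * G) ≤ ‖κ‖ := by nlinarith
      rw [show (N + 1) * (‖κ‖⁻¹ * G) = ‖κ‖⁻¹ * ((N + 1) * G) by ring, inv_mul_le_iff₀ hκ0]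
      linarith
    rw [hε, mul_add]; linarith
  have hε16 : ε ≤ 1 / 16 := by nlinarith
  -- weighted norms of the growing and the decaying mode
  set a : ℝ → ℝ := fun x ↦ Real.exp (-(k * x)) * ‖κ * y x + y₁ x‖ with ha
  set b : ℝ → ℝ := fun x ↦ Real.exp (-(k * x)) * ‖κ * y x - y₁ x‖ with hb
  have hy := h.continuousOn
  have hy₁ := h.continuousOn_quasi
  have hac : ContinuousOn a (Icc 0 Real.pi) :=
    ContinuousOn.mul (by fun_prop) ((hy.const_mul κ).add hy₁).norm
  have hbc : ContinuousOn b (Icc 0 Real.pi) :=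
    ContinuousOn.mul (by fun_prop) ((hy.const_mul κ).sub hy₁).norm
  obtain ⟨s, hs, hmax⟩ := isCompact_Icc.exists_isMaxOn (nonempty_Icc.2 Real.pi_pos.le)
    (hac.sup hbc)
  set m := a s ⊔ b s with hm
  have ham : ∀ t ∈ Icc 0 Real.pi, a t ≤ m := fun t ht ↦ le_sup_left.trans (hmax ht)
  have hbm : ∀ t ∈ Icc 0 Real.pi, b t ≤ m := fun t ht ↦ le_sup_right.trans (hmax ht)
  have hm0 : 0 ≤ m := le_trans (by simp only [ha]; positivity) (ham s hs)
  have hee : ∀ x, Real.exp (k * x) * Real.exp (-(k * x)) = 1 := fun x ↦ by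
    rw [← Real.exp_add, add_neg_cancel, Real.exp_zero]
  have haeq : ∀ t, ‖κ * y t + y₁ t‖ = Real.exp (k * t) * a t := fun t ↦ by
    simp only [ha]; rw [← mul_assoc, hee, one_mul]
  have hbeq : ∀ t, ‖κ * y t - y₁ t‖ = Real.exp (k * t) * b t := fun t ↦ by
    simp only [hb]; rw [← mul_assoc, hee, one_mul]
  have hym : ∀ t ∈ Icc 0 Real.pi, ‖κ‖ * ‖y t‖ ≤ Real.exp (k * t) * m := fun t ht ↦ by
    have h1 : 2 * (‖κ‖ * ‖y t‖) ≤ ‖κ * y t + y₁ t‖ + ‖κ * y t - y₁ t‖ := by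
      rw [← norm_mul, show (2 : ℝ) * ‖κ * y t‖ = ‖2 * (κ * y t)‖ by simp]
      refine le_trans (le_of_eq ?_) (norm_add_le _ _)
      congr 1; ring
    rw [haeq, hbeq] at h1
    have h2 := mul_le_mul_of_nonneg_left (ham t ht) (Real.exp_pos (k * t)).le
    have h3 := mul_le_mul_of_nonneg_left (hbm t ht) (Real.exp_pos (k * t)).le
    linarith
  have hnorm : ∀ t : ℝ, ‖Complex.exp (κ * t)‖ = Real.exp (k * t) := fun t ↦ by
    rw [Complex.norm_exp]; simp [hk]
  have hnorm' : ∀ t : ℝ, ‖Complex.exp (-κ * t)‖ = Real.exp (-(k * t)) := fun t ↦ by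
    rw [Complex.norm_exp]; simp [hk]
  -- the decaying mode
  have hbx : ∀ x ∈ Icc 0 Real.pi, b x ≤ Real.exp (-(2 * k * x)) * Q + ε * m := by
    intro x hx
    obtain ⟨i1, e1⟩ := h.exp_mul_eq hσ hx
    obtain ⟨i2, e2⟩ := integral_exp_sub_mul_le hσ hk0 le_rfl (inv_nonneg.2 hκ0.le) hx
    rw [← hG, zero_div, zero_add] at e2
    have e3 : Real.exp (k * x) * ‖κ * y x - y₁ x‖ ≤
        Q + (m * Real.exp (2 * k * x)) * ε := by
      rw [← hnorm, ← norm_mul, e1]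
      refine (norm_add_le _ _).trans (add_le_add_right
        ((intervalIntegral.norm_integral_le_of_norm_le hx.1 (ae_of_all _ fun t ht ↦ ?_)
          (i2.const_mul (m * Real.exp (2 * k * x)))).trans ?_) _)
      · have ht' : t ∈ Icc 0 Real.pi := ⟨ht.1.le, ht.2.trans hx.2⟩
        rw [norm_mul, hnorm]
        have n1 : ‖σ t * (κ * y t + y₁ t) + σ t ^ 2 * y t‖ ≤
            ‖σ t‖ * (Real.exp (k * t) * m) + ‖σ t‖ ^ 2 * (‖κ‖⁻¹ * (Real.exp (k * t) * m)) := by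
          refine (norm_add_le _ _).trans ?_
          rw [norm_mul, norm_mul, norm_pow, haeq]
          gcongr
          · exact ham t ht'
          · rw [le_inv_mul_iff₀ hκ0]; exact hym t ht'
        calc _ ≤ Real.exp (k * t) * (‖σ t‖ * (Real.exp (k * t) * m) +
              ‖σ t‖ ^ 2 * (‖κ‖⁻¹ * (Real.exp (k * t) * m))) := by gcongr
          _ = m * (Real.exp (k * t) * Real.exp (k * t)) * (‖σ t‖ + ‖κ‖⁻¹ * ‖σ t‖ ^ 2) := by ring
          _ = m * (Real.exp (2 * k * x) * Real.exp (2 * k * t - 2 * k * x)) *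
              (‖σ t‖ + ‖κ‖⁻¹ * ‖σ t‖ ^ 2) := by
            rw [← Real.exp_add, ← Real.exp_add]; ring_nf
          _ = _ := by ring
      · rw [intervalIntegral.integral_const_mul (m * Real.exp (2 * k * x))]
        gcongr
    have e4 : Real.exp (-(2 * k * x)) * Real.exp (k * x) = Real.exp (-(k * x)) := by
      rw [← Real.exp_add]; ring_nf
    have e5 : Real.exp (-(2 * k * x)) * Real.exp (2 * k * x) = 1 := by
      rw [← Real.exp_add, neg_add_cancel, Real.exp_zero]
    calc b x = Real.exp (-(2 * k * x)) * (Real.exp (k * x) * ‖κ * y x - y₁ x‖) := by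
          rw [← mul_assoc, e4]
      _ ≤ Real.exp (-(2 * k * x)) * (Q + (m * Real.exp (2 * k * x)) * ε) := by gcongr
      _ = Real.exp (-(2 * k * x)) * Q +
          (Real.exp (-(2 * k * x)) * Real.exp (2 * k * x)) * (ε * m) := by ring
      _ = _ := by rw [e5, one_mul]
  -- the growing mode
  have hax : ∀ x ∈ Icc 0 Real.pi,
      ‖Complex.exp (-κ * x) * (κ * y x + y₁ x) - (κ * y 0 + y₁ 0)‖ ≤
        ε * Q + (N + 1) * ε * m := by
    intro x hx
    obtain ⟨i1, e1⟩ := h.exp_neg_mul_eq hσ hx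
    have j1 := (intervalIntegrable_of_memLp_two hσ).norm.mono_right hx
    have j2 := (intervalIntegrable_norm_sq_of_memLp_two hσ).mono_right hx
    have j3 : IntervalIntegrable (fun t ↦ Real.exp (-(2 * k * t)) * ‖σ t‖) volume 0 x :=
      j1.continuousOn_mul (Continuous.continuousOn (by fun_prop))
    have e2 := integral_exp_neg_mul_norm_le hσ hk0 hx
    have e3 : ∫ t in (0 : ℝ)..x, ‖σ t‖ ≤ N :=
      intervalIntegral.integral_mono_interval le_rfl hx.1 hx.2 (ae_of_all _ fun _ ↦ norm_nonneg _)
        (intervalIntegrable_of_memLp_two hσ).norm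
    have e4 : ∫ t in (0 : ℝ)..x, ‖σ t‖ ^ 2 ≤ G :=
      intervalIntegral.integral_mono_interval le_rfl hx.1 hx.2
        (ae_of_all _ fun _ ↦ by positivity) (intervalIntegrable_norm_sq_of_memLp_two hσ)
    rw [e1, add_sub_cancel_left]
    refine (intervalIntegral.norm_integral_le_of_norm_le hx.1 (ae_of_all _ fun t ht ↦ ?_)
      (((j3.const_mul Q).add (j1.const_mul (ε * m))).add (j2.const_mul (‖κ‖⁻¹ * m)))).trans ?_
    · have ht' : t ∈ Icc 0 Real.pi := ⟨ht.1.le, ht.2.trans hx.2⟩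
      rw [norm_mul, hnorm']
      have n1 : ‖σ t * (κ * y t - y₁ t) - σ t ^ 2 * y t‖ ≤
          ‖σ t‖ * (Real.exp (k * t) * (Real.exp (-(2 * k * t)) * Q + ε * m)) +
            ‖σ t‖ ^ 2 * (‖κ‖⁻¹ * (Real.exp (k * t) * m)) := by
        refine (norm_sub_le _ _).trans ?_
        rw [norm_mul, norm_mul, norm_pow, hbeq]
        gcongr
        · exact hbx t ht'
        · rw [le_inv_mul_iff₀ hκ0]; exact hym t ht'
      calc _ ≤ Real.exp (-(k * t)) * _ := mul_le_mul_of_nonneg_left n1 (Real.exp_pos _).le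
        _ = (Real.exp (k * t) * Real.exp (-(k * t))) * (Q * (Real.exp (-(2 * k * t)) * ‖σ t‖) +
            ε * m * ‖σ t‖ + ‖κ‖⁻¹ * m * ‖σ t‖ ^ 2) := by ring
        _ = _ := by rw [hee, one_mul]
    · rw [intervalIntegral.integral_add ((j3.const_mul Q).add (j1.const_mul (ε * m)))
        (j2.const_mul (‖κ‖⁻¹ * m)), intervalIntegral.integral_add (j3.const_mul Q)
        (j1.const_mul (ε * m)), intervalIntegral.integral_const_mul,
        intervalIntegral.integral_const_mul, intervalIntegral.integral_const_mul]
      have q1 : (G + 1) / √(2 * k) ≤ ε := by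
        rw [hε]; exact le_add_of_nonneg_right (by positivity)
      have q2 : ‖κ‖⁻¹ * G ≤ ε := by
        rw [hε]; exact le_add_of_nonneg_left (by positivity)
      calc _ ≤ Q * ε + ε * m * N + ‖κ‖⁻¹ * m * G := by
            gcongr
            exact e2.trans q1
        _ = Q * ε + ε * m * N + m * (‖κ‖⁻¹ * G) := by ring
        _ ≤ Q * ε + ε * m * N + m * ε := by gcongr
        _ = _ := by ring
  have hax1 : ∀ x ∈ Icc 0 Real.pi, ε * Q + (N + 1) * ε * m ≤ P / 8 + m / 16 := fun x hx ↦ by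
    have : ε * Q ≤ 1 / 16 * (2 * P) := by gcongr
    have := mul_le_mul_of_nonneg_right hsmall hm0
    linarith
  have hanorm : ∀ x, a x = ‖Complex.exp (-κ * x) * (κ * y x + y₁ x)‖ := fun x ↦ by
    rw [norm_mul, hnorm']
  have hεm : ε * m ≤ m / 16 := by nlinarith
  have hm3 : m ≤ 32 / 15 * P := by
    rcases le_total (b s) (a s) with hc | hc
    · have h1 : m = a s := sup_of_le_left hc
      have h2 := norm_le_norm_add_norm_sub' (Complex.exp (-κ * s) * (κ * y s + y₁ s))
        (κ * y 0 + y₁ 0)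
      have h3 := hax s hs
      rw [← hanorm] at h2
      linarith [hax1 s hs]
    · have h1 : m = b s := sup_of_le_right hc
      have h2 := hbx s hs
      have h3 : Real.exp (-(2 * k * s)) * Q ≤ 1 * (2 * P) := by
        gcongr
        rw [Real.exp_le_one_iff]; nlinarith [hs.1]
      linarith
  refine ⟨fun x hx ↦ (hym x hx).trans ?_, ?_⟩
  · rw [mul_comm]; gcongr; linarith
  · have hpi : Real.pi ∈ Icc 0 Real.pi := ⟨Real.pi_pos.le, le_rfl⟩
    have h1 := norm_sub_norm_le (κ * y 0 + y₁ 0)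
      (Complex.exp (-κ * Real.pi) * (κ * y Real.pi + y₁ Real.pi))
    rw [← hanorm, norm_sub_rev] at h1
    have h2 := hax _ hpi
    have h3 := hax1 _ hpi
    have h4 := hbx _ hpi
    have h5 : Real.exp (-(2 * k * Real.pi)) ≤ 1 / 16 := by
      rw [Real.exp_neg, ← one_div]
      refine one_div_le_one_div_of_le (by norm_num) ?_
      have := Real.add_one_le_exp (2 * k * Real.pi)
      nlinarith [Real.pi_gt_three]
    have h6 : Real.exp (-(2 * k * Real.pi)) * Q ≤ 1 / 16 * (2 * P) := by gcongr
    have h7 : a Real.pi - b Real.pi ≤ 2 * (Real.exp (-(k * Real.pi)) * ‖y₁ Real.pi‖) := by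
      have : ‖κ * y Real.pi + y₁ Real.pi‖ - ‖κ * y Real.pi - y₁ Real.pi‖ ≤ 2 * ‖y₁ Real.pi‖ := by
        refine (norm_sub_norm_le _ _).trans (le_of_eq ?_)
        rw [show κ * y Real.pi + y₁ Real.pi - (κ * y Real.pi - y₁ Real.pi) = 2 * y₁ Real.pi by ring]
        simp
      have := mul_le_mul_of_nonneg_left this (Real.exp_pos (-(k * Real.pi))).le
      simp only [ha, hb]
      linarith
    have h8 : P ≤ 8 * (Real.exp (-(k * Real.pi)) * ‖y₁ Real.pi‖) := by linarith
    calc P * Real.exp (k * Real.pi) ≤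
          8 * (Real.exp (-(k * Real.pi)) * ‖y₁ Real.pi‖) * Real.exp (k * Real.pi) := by gcongr
      _ = 8 * ‖y₁ Real.pi‖ * (Real.exp (k * Real.pi) * Real.exp (-(k * Real.pi))) := by ring
      _ = _ := by rw [hee, mul_one]

end IsQuasiSolution

/-! ### A Phragmén–Lindelöf argument -/

/-- An entire function `F` of order `1 / 2` which decays along a sector `‖κ‖ ≤ 2 re κ`,
`lam = -κ²`, vanishes identically. Only the four rays `lam = ± i s` matter: for
`G w = F (-((1 + i) w)²)` they become the four half-axes, where the Phragmén–Lindelöf principle for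
quadrants applies. -/
theorem eq_zero_of_growth_of_decay {F : ℂ → ℂ} (hF : Differentiable ℂ F) {K B C D : ℝ} (hK : 1 ≤ K)
    (hgrow : ∀ κ : ℂ, K ≤ ‖κ‖ → ‖F (-κ ^ 2)‖ ≤ C * Real.exp (B * ‖κ‖))
    (hdecay : ∀ κ : ℂ, K ≤ ‖κ‖ → ‖κ‖ ≤ 2 * κ.re → ‖F (-κ ^ 2)‖ ≤ D / ‖κ‖) (z : ℂ) : F z = 0 := by
  set ω : ℂ := 1 + Complex.I with hω
  have hω0 : ω ≠ 0 := fun h ↦ by simpa [hω] using congrArg Complex.re h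
  have hnsq : ‖ω‖ ^ 2 = 2 := by
    rw [← Complex.normSq_eq_norm_sq, hω, Complex.normSq_apply]; norm_num
  have hn1 : 1 ≤ ‖ω‖ := by nlinarith [norm_nonneg ω]
  have hn2 : ‖ω‖ ≤ 2 := by nlinarith [norm_nonneg ω]
  set ω' : ℂ := 1 - Complex.I with hω'
  have hn' : ‖ω'‖ = ‖ω‖ := by
    rw [← Complex.norm_conj ω]; simp [hω, hω', sub_eq_add_neg]
  set G : ℂ → ℂ := fun w ↦ F (-(w * ω) ^ 2) with hG
  have hGd : Differentiable ℂ G := hF.comp (by fun_prop)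
  have hre : ∀ t : ℝ, K ≤ |t| → ‖G t‖ ≤ D / |t| ∧ ‖G (t * Complex.I)‖ ≤ D / |t| := by
    intro t ht
    have ht0 : 0 < |t| := by linarith
    have key : ∀ η : ℂ, η.re = 1 → ‖η‖ = ‖ω‖ → ‖F (-((|t| : ℝ) * η) ^ 2)‖ ≤ D / |t| := fun η h1 h2 ↦ by
      have hn : ‖((|t| : ℝ) : ℂ) * η‖ = |t| * ‖ω‖ := by rw [norm_mul, h2]; simp
      have h3 := hdecay ((|t| : ℝ) * η) (by rw [hn]; nlinarith) (by
        rw [hn, Complex.re_ofReal_mul, h1]; nlinarith)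
      have h4 : 0 ≤ D := by
        by_contra hD
        have : D / ‖((|t| : ℝ) : ℂ) * η‖ < 0 := div_neg_of_neg_of_pos (not_le.1 hD)
          (by rw [hn]; positivity)
        linarith [norm_nonneg (F (-(|t| * η) ^ 2))]
      refine h3.trans ?_
      rw [hn]
      gcongr
      nlinarith
    have hsq : ((|t| : ℝ) : ℂ) ^ 2 = (t : ℂ) ^ 2 := by
      rw [← Complex.ofReal_pow, sq_abs, Complex.ofReal_pow]
    constructor
    · have h1 := key ω (by simp [hω]) rfl
      rw [mul_pow, hsq, ← mul_pow] at h1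
      exact h1
    · have h1 := key ω' (by simp [hω']) hn'
      have h2 : (((|t| : ℝ) : ℂ) * ω') ^ 2 = (t * Complex.I * ω) ^ 2 := by
        rw [mul_pow, hsq, hω, hω']
        linear_combination (t : ℂ) ^ 2 * (1 - Complex.I ^ 2 - 2 * Complex.I) * Complex.I_sq
      rw [h2] at h1
      exact h1
  -- a common bound on the four half-axes
  obtain ⟨M, hM⟩ := (isCompact_closedBall (0 : ℂ) K).exists_bound_of_continuousOn
    hGd.continuous.continuousOn
  set A := max M D with hA
  have hD0 : 0 ≤ D := by
    have h1 := (hre K (le_abs_self K)).1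
    have h2 := (norm_nonneg _).trans h1
    rw [abs_of_nonneg (by linarith)] at h2
    exact (div_nonneg_iff.1 h2).elim And.left fun h ↦ absurd h.2 (by linarith)
  have hax : ∀ t : ℝ, ‖G t‖ ≤ A ∧ ‖G (t * Complex.I)‖ ≤ A := by
    intro t
    rcases le_total K |t| with ht | ht
    · have h1 : D / |t| ≤ A := (div_le_self hD0 (hK.trans ht)).trans (le_max_right _ _)
      exact ⟨(hre t ht).1.trans h1, (hre t ht).2.trans h1⟩
    · exact ⟨(hM _ (by simpa using ht)).trans (le_max_left _ _),
        (hM _ (by simpa using ht)).trans (le_max_left _ _)⟩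
  have hO : ∀ s : Set ℂ, ∃ c < (2 : ℝ), ∃ b, G =O[Bornology.cobounded ℂ ⊓ 𝓟 s]
      fun w ↦ Real.exp (b * ‖w‖ ^ c) := by
    intro s
    refine ⟨1, one_lt_two, B * ‖ω‖, Asymptotics.IsBigO.mono ?_ inf_le_left⟩
    refine Asymptotics.IsBigO.of_bound C ?_
    filter_upwards [hasBasis_cobounded_norm.mem_of_mem (i := K) trivial] with w hw
    have h1 : ‖w * ω‖ = ‖w‖ * ‖ω‖ := norm_mul _ _
    have h2 := hgrow (w * ω) (by
      rw [h1]; exact le_trans hw (le_mul_of_one_le_right (norm_nonneg _) hn1))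
    rw [Real.rpow_one, Real.norm_of_nonneg (Real.exp_pos _).le]
    refine h2.trans (le_of_eq ?_)
    rw [h1]; ring_nf
  have hbound : ∀ w, ‖G w‖ ≤ A := by
    intro w
    rcases le_total 0 w.re with hr | hr <;> rcases le_total 0 w.im with hi | hi
    · exact PhragmenLindelof.quadrant_I hGd.diffContOnCl (hO _) (fun x _ ↦ (hax x).1)
        (fun x _ ↦ (hax x).2) hr hi
    · exact PhragmenLindelof.quadrant_IV hGd.diffContOnCl (hO _) (fun x _ ↦ (hax x).1)
        (fun x _ ↦ (hax x).2) hr hi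
    · exact PhragmenLindelof.quadrant_II hGd.diffContOnCl (hO _) (fun x _ ↦ (hax x).1)
        (fun x _ ↦ (hax x).2) hr hi
    · exact PhragmenLindelof.quadrant_III hGd.diffContOnCl (hO _) (fun x _ ↦ (hax x).1)
        (fun x _ ↦ (hax x).2) hr hi
  have hconst : ∀ w, G w = G 0 := fun w ↦ hGd.apply_eq_apply_of_bounded
    (isBounded_iff_forall_norm_le.2 ⟨A, by rintro _ ⟨w, rfl⟩; exact hbound w⟩) w 0
  have hzero : G 0 = 0 := by
    have h1 : Tendsto (fun t : ℝ ↦ D / t) atTop (𝓝 0) := tendsto_const_nhds.div_atTop tendsto_id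
    refine norm_le_zero_iff.1 (ge_of_tendsto h1 ?_)
    filter_upwards [eventually_ge_atTop K] with t ht
    have h2 := (hre t (by rwa [abs_of_nonneg (by linarith)])).1
    rwa [hconst, abs_of_nonneg (by linarith)] at h2
  obtain ⟨u, hu⟩ := IsAlgClosed.exists_pow_nat_eq (-z) two_pos
  calc F z = G (u / ω) := by
        simp only [hG]
        rw [div_mul_cancel₀ _ hω0, hu, neg_neg]
    _ = 0 := by rw [hconst, hzero]

/-! ### Boundary data at large spectral parameter -/

open Polynomial in
/-- Boundary data of a normalized pair are never close to the decaying mode: `κ r₁(-κ²)` and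
`r₂(-κ²)` have leading terms of different parity in `κ`, so that one of them dominates. -/
theorem IsNormalizedPair.exists_norm_sub_le {r₁ r₂ : ℂ[X]} (h : IsNormalizedPair r₁ r₂) :
    ∃ K : ℝ, ∀ κ : ℂ, K ≤ ‖κ‖ →
      ‖κ * r₁.eval (-κ ^ 2) - r₂.eval (-κ ^ 2)‖ ≤ 2 * ‖κ * r₁.eval (-κ ^ 2) + r₂.eval (-κ ^ 2)‖ ∧
        0 < ‖κ * r₁.eval (-κ ^ 2) + r₂.eval (-κ ^ 2)‖ := by
  have dom : ∀ u v : ℂ, u ≠ 0 → 3 * ‖v‖ ≤ ‖u‖ → ‖u - v‖ ≤ 2 * ‖u + v‖ ∧ 0 < ‖u + v‖ := by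
    intro u v hu huv
    have h1 := norm_sub_le u v
    have h2 : ‖u‖ - ‖v‖ ≤ ‖u + v‖ := by simpa using norm_sub_norm_le u (-v)
    have h3 := norm_pos_iff.2 hu
    constructor <;> linarith
  have ev : ∀ p q : ℂ[X], q ≠ 0 → p.degree ≤ q.degree → ∃ C K : ℝ, 0 < C ∧ 1 ≤ K ∧
      ∀ κ : ℂ, K ≤ ‖κ‖ → q.eval (-κ ^ 2) ≠ 0 ∧ ‖p.eval (-κ ^ 2)‖ ≤ C * ‖q.eval (-κ ^ 2)‖ := by
    intro p q hq hpq
    obtain ⟨C, hC, hO⟩ := (isBigO_cobounded_of_degree_le hpq).exists_pos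
    have h1 : ∀ᶠ x in Bornology.cobounded ℂ, ¬q.IsRoot x :=
      Bornology.le_cofinite ℂ (eventually_cofinite_not_isRoot hq)
    obtain ⟨K, -, hK⟩ := hasBasis_cobounded_norm.eventually_iff.1 (hO.bound.and h1)
    refine ⟨C, max K 1, hC, le_max_right _ _, fun κ hκ ↦ ?_⟩
    have hκ1 : 1 ≤ ‖κ‖ := (le_max_right _ _).trans hκ
    obtain ⟨h2, h3⟩ := hK (x := -κ ^ 2) (by
      change K ≤ ‖-κ ^ 2‖
      rw [norm_neg, norm_pow]
      nlinarith [(le_max_left K 1).trans hκ])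
    exact ⟨h3, h2⟩
  rcases h with ⟨hd, hm⟩ | ⟨hd, hm⟩
  · obtain ⟨C, K, hC, hK1, hK⟩ := ev r₂ r₁ hm.ne_zero hd
    refine ⟨max K (3 * C), fun κ hκ ↦ ?_⟩
    obtain ⟨h1, h2⟩ := hK κ ((le_max_left _ _).trans hκ)
    have h3 : 3 * C ≤ ‖κ‖ := (le_max_right _ _).trans hκ
    have h4 : κ ≠ 0 := norm_pos_iff.1 (by linarith)
    refine dom _ _ (mul_ne_zero h4 h1) ?_
    rw [norm_mul]
    nlinarith [mul_le_mul_of_nonneg_right h3 (norm_nonneg (r₁.eval (-κ ^ 2)))]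
  · have hd' : (X * r₁).degree ≤ r₂.degree := by
      rw [mul_comm, degree_mul_X]
      exact Nat.WithBot.add_one_le_of_lt hd
    obtain ⟨C, K, hC, hK1, hK⟩ := ev _ r₂ hm.ne_zero hd'
    refine ⟨max K (3 * C), fun κ hκ ↦ ?_⟩
    obtain ⟨h1, h2⟩ := hK κ ((le_max_left _ _).trans hκ)
    have h3 : 3 * C ≤ ‖κ‖ := (le_max_right _ _).trans hκ
    have hκ0 : 0 < ‖κ‖ := by linarith
    rw [eval_mul, eval_X, norm_mul, norm_neg, norm_pow] at h2
    have h5 : 3 * ‖κ * r₁.eval (-κ ^ 2)‖ ≤ ‖r₂.eval (-κ ^ 2)‖ := by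
      rw [norm_mul]
      have h6 : ‖κ‖ * (3 * (‖κ‖ * ‖r₁.eval (-κ ^ 2)‖)) ≤ ‖κ‖ * ‖r₂.eval (-κ ^ 2)‖ := by
        nlinarith [mul_le_mul_of_nonneg_right h3 (norm_nonneg (r₂.eval (-κ ^ 2)))]
      exact le_of_mul_le_mul_left h6 hκ0
    obtain ⟨h7, h8⟩ := dom _ _ h1 h5
    rw [norm_sub_rev, add_comm]
    exact ⟨h7, h8⟩

/-! ### Fundamental systems and Weyl solutions -/

/-- The solutions `φ`, `S` of the equation with `φ(0) = 1`, `φ^{[1]}(0) = 0` and `S(0) = 0`,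
`S^{[1]}(0) = 1`, for all values of the spectral parameter, as entire functions of it. -/
structure IsFundamentalSystem (σ : ℝ → ℂ) (φ φ₁ S S₁ : ℂ → ℝ → ℂ) : Prop where
  cosine : ∀ lam, IsQuasiSolution σ lam (φ lam) (φ₁ lam)
  sine : ∀ lam, IsQuasiSolution σ lam (S lam) (S₁ lam)
  cosine_zero : ∀ lam, φ lam 0 = 1
  cosine_quasi_zero : ∀ lam, φ₁ lam 0 = 0
  sine_zero : ∀ lam, S lam 0 = 0
  sine_quasi_zero : ∀ lam, S₁ lam 0 = 1
  differentiable_cosine : ∀ x, Differentiable ℂ fun lam ↦ φ lam x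
  differentiable_sine : ∀ x, Differentiable ℂ fun lam ↦ S lam x

theorem exists_isFundamentalSystem {σ : ℝ → ℂ}
    (hσ : MemLp σ 2 (volume.restrict (Ioo (0 : ℝ) Real.pi))) :
    ∃ φ φ₁ S S₁, IsFundamentalSystem σ φ φ₁ S S₁ := by
  obtain ⟨φ, φ₁, h1, h2, h3, h4⟩ := exists_isQuasiSolution_entire hσ 1 0
  obtain ⟨S, S₁, k1, k2, k3, k4⟩ := exists_isQuasiSolution_entire hσ 0 1
  exact ⟨φ, φ₁, S, S₁, h1, k1, h2, h3, k2, k3, h4, k4⟩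

namespace IsFundamentalSystem

variable {σ σ' : ℝ → ℂ} {φ φ₁ S S₁ φ' φ₁' S' S₁' : ℂ → ℝ → ℂ}

theorem wronskian (h : IsFundamentalSystem σ φ φ₁ S S₁) (lam : ℂ) {x : ℝ}
    (hx : x ∈ Icc 0 Real.pi) : φ lam x * S₁ lam x - S lam x * φ₁ lam x = 1 := by
  rw [(h.cosine lam).wronskian_eq (h.sine lam) hx, h.cosine_zero, h.cosine_quasi_zero,
    h.sine_zero, h.sine_quasi_zero]
  ring

/-- In the sector `‖κ‖ ≤ 2 re κ` the Weyl function is defined for large `κ`, and the Weyl solution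
`S - m φ`, which is proportional to `ψ`, decays. -/
theorem exists_weyl_solution (hσ : MemLp σ 2 (volume.restrict (Ioo (0 : ℝ) Real.pi)))
    (h : IsFundamentalSystem σ φ φ₁ S S₁) {r₁ r₂ : Polynomial ℂ} (hN : IsNormalizedPair r₁ r₂) :
    ∃ K : ℝ, ∀ κ : ℂ, K ≤ ‖κ‖ → ‖κ‖ ≤ 2 * κ.re → ∃ m B : ℂ, B ≠ 0 ∧
      HasWeylValue σ r₁ r₂ (-κ ^ 2) m ∧
      r₁.eval (-κ ^ 2) = B * (S (-κ ^ 2) Real.pi - m * φ (-κ ^ 2) Real.pi) ∧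
      -r₂.eval (-κ ^ 2) = B * (S₁ (-κ ^ 2) Real.pi - m * φ₁ (-κ ^ 2) Real.pi) ∧
      ∀ x ∈ Icc 0 Real.pi,
        ‖κ‖ * ‖S (-κ ^ 2) x - m * φ (-κ ^ 2) x‖ ≤ 24 * Real.exp (-(κ.re * x)) := by
  obtain ⟨K₁, -, hK₁⟩ := IsQuasiSolution.exists_sectorial_bounds hσ.neg_reflect
  obtain ⟨K₂, hK₂⟩ := hN.exists_norm_sub_le
  refine ⟨max K₁ K₂, fun κ hκ hre ↦ ?_⟩
  obtain ⟨h1, h2⟩ := hK₂ κ ((le_max_right _ _).trans hκ)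
  set lam := -κ ^ 2 with hlam
  have hpi : Real.pi ∈ Icc 0 Real.pi := ⟨Real.pi_pos.le, le_rfl⟩
  have hW := h.wronskian lam hpi
  -- Cramer's rule for the coordinates of `ψ` in the fundamental system
  set A := r₁.eval lam * S₁ lam Real.pi + r₂.eval lam * S lam Real.pi with hA
  set B := -(r₂.eval lam * φ lam Real.pi) - r₁.eval lam * φ₁ lam Real.pi with hB
  have hψ := (h.cosine lam).linear_combination (h.sine lam) A B
  have e1 : A * φ lam Real.pi + B * S lam Real.pi = r₁.eval lam := by
    rw [hA, hB]; linear_combination r₁.eval lam * hW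
  have e2 : A * φ₁ lam Real.pi + B * S₁ lam Real.pi = -r₂.eval lam := by
    rw [hA, hB]; linear_combination -r₂.eval lam * hW
  have hrefl := hψ.reflect hσ
  obtain ⟨b1, b2⟩ := hK₁ κ _ _ ((le_max_left _ _).trans hκ) hre hrefl (by
    simp only [sub_zero]
    rw [e1, e2, neg_neg]
    exact h1)
  simp only [sub_zero, sub_self] at b1 b2
  rw [e2, e1, neg_neg] at b1 b2
  rw [h.cosine_quasi_zero, h.sine_quasi_zero, mul_zero, zero_add, mul_one, norm_neg] at b2
  set P := ‖κ * r₁.eval lam + r₂.eval lam‖ with hP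
  have hBn : 0 < ‖B‖ := by
    have : 0 < P * Real.exp (κ.re * Real.pi) := by positivity
    linarith
  have hB0 : B ≠ 0 := norm_pos_iff.1 hBn
  refine ⟨-(A / B), B, hB0, ⟨_, _, ⟨hψ, e1, e2⟩, ?_, ?_⟩, ?_, ?_, fun x hx ↦ ?_⟩
  · rw [h.cosine_quasi_zero, h.sine_quasi_zero]; simpa using hB0
  · rw [h.cosine_quasi_zero, h.sine_quasi_zero, h.cosine_zero, h.sine_zero]; simp
  · rw [← e1]; field_simp; ring
  · rw [← e2]; field_simp; ring
  · have b3 := b1 (Real.pi - x) ⟨by linarith [hx.2], by linarith [hx.1]⟩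
    rw [sub_sub_cancel] at b3
    have e3 : S lam x - -(A / B) * φ lam x = (A * φ lam x + B * S lam x) / B := by
      field_simp; ring
    rw [e3, norm_div, ← mul_div_assoc, div_le_iff₀ hBn]
    calc _ ≤ _ := b3
      _ = 3 * (P * Real.exp (κ.re * Real.pi)) * Real.exp (-(κ.re * x)) := by
          rw [show κ.re * (Real.pi - x) = κ.re * Real.pi + -(κ.re * x) by ring, Real.exp_add]
          ring
      _ ≤ 3 * (8 * ‖B‖) * Real.exp (-(κ.re * x)) := by gcongr
      _ = _ := by ring

theorem exists_norm_cosine_le (hσ : MemLp σ 2 (volume.restrict (Ioo (0 : ℝ) Real.pi)))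
    (h : IsFundamentalSystem σ φ φ₁ S S₁) :
    ∃ K : ℝ, 1 ≤ K ∧ ∀ κ : ℂ, K ≤ ‖κ‖ → ‖κ‖ ≤ 2 * κ.re →
      ∀ x ∈ Icc 0 Real.pi, ‖φ (-κ ^ 2) x‖ ≤ 3 * Real.exp (κ.re * x) := by
  obtain ⟨K, hK1, hK⟩ := IsQuasiSolution.exists_sectorial_bounds hσ
  refine ⟨K, hK1, fun κ hκ hre x hx ↦ ?_⟩
  have hκ0 : 0 < ‖κ‖ := by linarith
  have h1 := (hK κ _ _ hκ hre (h.cosine _) (by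
    rw [h.cosine_zero, h.cosine_quasi_zero, sub_zero, add_zero]
    linarith [norm_nonneg (κ * 1)])).1 x hx
  rw [h.cosine_zero, h.cosine_quasi_zero, add_zero, mul_one, mul_comm 3, mul_assoc] at h1
  exact le_of_mul_le_mul_left h1 hκ0

theorem exists_norm_le (hσ : MemLp σ 2 (volume.restrict (Ioo (0 : ℝ) Real.pi)))
    (h : IsFundamentalSystem σ φ φ₁ S S₁) :
    ∃ K : ℝ, 1 ≤ K ∧ ∀ κ : ℂ, K ≤ ‖κ‖ → ∀ x ∈ Icc 0 Real.pi,
      ‖φ (-κ ^ 2) x‖ ≤ 2 * Real.exp (4 * ‖κ‖ * Real.pi) ∧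
        ‖S (-κ ^ 2) x‖ ≤ 2 * Real.exp (4 * ‖κ‖ * Real.pi) := by
  obtain ⟨K, hK1, hK⟩ := IsQuasiSolution.exists_norm_le_exp hσ
  refine ⟨K, hK1, fun κ hκ x hx ↦ ?_⟩
  have hκ1 : 1 ≤ ‖κ‖ := hK1.trans hκ
  have hκ0 : 0 < ‖κ‖ := by linarith
  have h1 := hK κ _ _ hκ (h.cosine _) x hx
  have h2 := hK κ _ _ hκ (h.sine _) x hx
  rw [h.cosine_zero, h.cosine_quasi_zero, norm_zero, add_zero, norm_one, mul_one, mul_comm 2,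
    mul_assoc] at h1
  rw [h.sine_zero, h.sine_quasi_zero, norm_zero, mul_zero, zero_add, norm_one, mul_one] at h2
  exact ⟨le_of_mul_le_mul_left h1 hκ0,
    (le_mul_of_one_le_left (norm_nonneg _) hκ1).trans h2⟩

/-- If two problems have decaying solutions `S - m φ`, `S' - m φ'` with the same `m`, then the
entire functions `φ S' - S φ'` vanish: they have order `1 / 2`, and in terms of the decaying
solutions they are `φ (S' - m φ') - φ' (S - m φ)`. -/
theorem mul_eq_mul_of_weyl (hσ : MemLp σ 2 (volume.restrict (Ioo (0 : ℝ) Real.pi)))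
    (hσ' : MemLp σ' 2 (volume.restrict (Ioo (0 : ℝ) Real.pi)))
    (h : IsFundamentalSystem σ φ φ₁ S S₁) (h' : IsFundamentalSystem σ' φ' φ₁' S' S₁') {K : ℝ}
    (hm : ∀ κ : ℂ, K ≤ ‖κ‖ → ‖κ‖ ≤ 2 * κ.re → ∃ m : ℂ, ∀ x ∈ Icc 0 Real.pi,
      ‖κ‖ * ‖S (-κ ^ 2) x - m * φ (-κ ^ 2) x‖ ≤ 24 * Real.exp (-(κ.re * x)) ∧
      ‖κ‖ * ‖S' (-κ ^ 2) x - m * φ' (-κ ^ 2) x‖ ≤ 24 * Real.exp (-(κ.re * x)))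
    (lam : ℂ) {x : ℝ} (hx : x ∈ Icc 0 Real.pi) :
    φ lam x * S' lam x = S lam x * φ' lam x := by
  obtain ⟨K₁, hK₁, b1⟩ := h.exists_norm_cosine_le hσ
  obtain ⟨K₂, hK₂, b2⟩ := h'.exists_norm_cosine_le hσ'
  obtain ⟨K₃, hK₃, b3⟩ := h.exists_norm_le hσ
  obtain ⟨K₄, hK₄, b4⟩ := h'.exists_norm_le hσ'
  refine sub_eq_zero.1 (eq_zero_of_growth_of_decay
    (F := fun lam ↦ φ lam x * S' lam x - S lam x * φ' lam x)
    (((h.differentiable_cosine x).mul (h'.differentiable_sine x)).sub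
      ((h.differentiable_sine x).mul (h'.differentiable_cosine x)))
    (K := max (max K K₁) (max K₂ (max K₃ K₄))) (B := 8 * Real.pi) (C := 8) (D := 144)
    (by simp [hK₁]) (fun κ hκ ↦ ?_) (fun κ hκ hre ↦ ?_) lam)
  · simp only [max_le_iff] at hκ
    obtain ⟨⟨-, -⟩, -, k3, k4⟩ := hκ
    obtain ⟨c1, c2⟩ := b3 κ k3 x hx
    obtain ⟨c3, c4⟩ := b4 κ k4 x hx
    refine (norm_sub_le _ _).trans ?_
    rw [norm_mul, norm_mul]
    calc _ ≤ 2 * Real.exp (4 * ‖κ‖ * Real.pi) * (2 * Real.exp (4 * ‖κ‖ * Real.pi)) +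
          2 * Real.exp (4 * ‖κ‖ * Real.pi) * (2 * Real.exp (4 * ‖κ‖ * Real.pi)) := by gcongr
      _ = 8 * (Real.exp (4 * ‖κ‖ * Real.pi) * Real.exp (4 * ‖κ‖ * Real.pi)) := by ring
      _ = _ := by rw [← Real.exp_add]; ring_nf
  · simp only [max_le_iff] at hκ
    obtain ⟨⟨k0, k1⟩, k2, -, -⟩ := hκ
    have hκ0 : 0 < ‖κ‖ := by linarith
    obtain ⟨m, hm⟩ := hm κ k0 hre
    obtain ⟨d1, d2⟩ := hm x hx
    have c1 := b1 κ k1 hre x hx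
    have c2 := b2 κ k2 hre x hx
    have e : φ (-κ ^ 2) x * S' (-κ ^ 2) x - S (-κ ^ 2) x * φ' (-κ ^ 2) x =
        φ (-κ ^ 2) x * (S' (-κ ^ 2) x - m * φ' (-κ ^ 2) x) -
          φ' (-κ ^ 2) x * (S (-κ ^ 2) x - m * φ (-κ ^ 2) x) := by ring
    have e' : Real.exp (κ.re * x) * Real.exp (-(κ.re * x)) = 1 := by
      rw [← Real.exp_add, add_neg_cancel, Real.exp_zero]
    rw [le_div_iff₀ hκ0, e]
    refine (mul_le_mul_of_nonneg_right (norm_sub_le _ _) hκ0.le).trans ?_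
    rw [norm_mul, norm_mul]
    calc _ = ‖φ (-κ ^ 2) x‖ * (‖κ‖ * ‖S' (-κ ^ 2) x - m * φ' (-κ ^ 2) x‖) +
          ‖φ' (-κ ^ 2) x‖ * (‖κ‖ * ‖S (-κ ^ 2) x - m * φ (-κ ^ 2) x‖) := by ring
      _ ≤ 3 * Real.exp (κ.re * x) * (24 * Real.exp (-(κ.re * x))) +
          3 * Real.exp (κ.re * x) * (24 * Real.exp (-(κ.re * x))) := by gcongr
      _ = 144 * (Real.exp (κ.re * x) * Real.exp (-(κ.re * x))) := by ring
      _ = 144 := by rw [e', mul_one]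

/-- If `φ S' = S φ'` on `[0, π]`, then the two fundamental systems have the same solutions: the
ratio `S / φ` determines `φ` because its derivative is the reciprocal of `φ²`, up to a sign that is
fixed at `0`. -/
theorem eqOn_of_mul_eq_mul (h : IsFundamentalSystem σ φ φ₁ S S₁)
    (h' : IsFundamentalSystem σ' φ' φ₁' S' S₁') {lam : ℂ}
    (hF : ∀ x ∈ Icc 0 Real.pi, φ lam x * S' lam x = S lam x * φ' lam x) :
    EqOn (φ' lam) (φ lam) (Icc 0 Real.pi) ∧ EqOn (S' lam) (S lam) (Icc 0 Real.pi) := by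
  -- `(φ', S') = c (φ, S)`, and comparing Wronskians gives `c² = 1`
  set c : ℝ → ℂ := fun x ↦ φ' lam x * S₁ lam x - S' lam x * φ₁ lam x with hc
  have hcφ : ∀ x ∈ Icc 0 Real.pi, φ' lam x = c x * φ lam x := fun x hx ↦ by
    simp only [hc]
    linear_combination -φ' lam x * h.wronskian lam hx + φ₁ lam x * hF x hx
  have hcS : ∀ x ∈ Icc 0 Real.pi, S' lam x = c x * S lam x := fun x hx ↦ by
    simp only [hc]
    linear_combination -S' lam x * h.wronskian lam hx + S₁ lam x * hF x hx
  have hcAC : AbsolutelyContinuousOnInterval c 0 Real.pi :=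
    ((h'.cosine lam).1.fun_smul (h.sine lam).2).fun_sub
      ((h'.sine lam).1.fun_smul (h.cosine lam).2)
  have hcc : ContinuousOn c (Icc 0 Real.pi) := by
    simpa only [uIcc_of_le Real.pi_pos.le] using hcAC.continuousOn
  have hd : ∀ᵐ x ∂volume.restrict (Ioo (0 : ℝ) Real.pi), c x ^ 2 = 1 ∧ ∃ c', HasDerivAt c c' x := by
    filter_upwards [(h.cosine lam).3, (h.cosine lam).4, (h.sine lam).3, (h.sine lam).4,
      (h'.cosine lam).3, (h'.sine lam).3, ae_restrict_mem measurableSet_Ioo]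
      with x a1 a2 a3 a4 a5 a6 hx
    have hx' := Ioo_subset_Icc_self hx
    obtain ⟨c', hc'⟩ : ∃ c', HasDerivAt c c' x := ⟨_, (a5.mul a4).sub (a6.mul a2)⟩
    refine ⟨?_, c', hc'⟩
    have hnhds : Icc 0 Real.pi ∈ 𝓝 x := Icc_mem_nhds hx.1 hx.2
    have u1 := a5.unique ((hc'.mul a1).congr_of_eventuallyEq
      (by filter_upwards [hnhds] with t ht using hcφ t ht))
    have u2 := a6.unique ((hc'.mul a3).congr_of_eventuallyEq
      (by filter_upwards [hnhds] with t ht using hcS t ht))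
    have w := h.wronskian lam hx'
    have w' := h'.wronskian lam hx'
    rw [hcφ x hx'] at w' u1
    rw [hcS x hx'] at w' u2
    linear_combination w' + c x * (S lam x * u1 - φ lam x * u2) - c x ^ 2 * w
  have hc1 : EqOn (fun x ↦ c x ^ 2) (fun _ ↦ 1) (Icc 0 Real.pi) :=
    Measure.eqOn_Icc_of_ae_eq volume Real.pi_pos.ne
      (by
        rw [← Measure.restrict_congr_set Ioo_ae_eq_Icc]
        filter_upwards [hd] with x hx using hx.1) (hcc.pow 2) continuousOn_const
  have hcd : ∀ᵐ x ∂volume.restrict (Ioo (0 : ℝ) Real.pi), HasDerivAt c 0 x := by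
    filter_upwards [hd, ae_restrict_mem measurableSet_Ioo] with x hx hx'
    obtain ⟨h1, c', hc'⟩ := hx
    have u := ((hc'.pow 2).congr_of_eventuallyEq (f₁ := fun _ ↦ (1 : ℂ)) (by
      filter_upwards [Icc_mem_nhds hx'.1 hx'.2] with t ht using (hc1 ht).symm)).unique
      (hasDerivAt_const x (1 : ℂ))
    have hc0 : c x ≠ 0 := fun h0 ↦ by rw [h0] at h1; norm_num at h1
    have : c' = 0 := by simpa [hc0] using u
    rwa [this] at hc'
  have hcone : ∀ x ∈ Icc 0 Real.pi, c x = 1 := fun x hx ↦ by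
    rw [hcAC.eq_left_of_ae_hasDerivAt_zero Real.pi_pos.le hcd hx]
    simp [hc, h.cosine_quasi_zero, h.sine_quasi_zero, h'.cosine_zero]
  exact ⟨fun x hx ↦ by rw [hcφ x hx, hcone x hx, one_mul],
    fun x hx ↦ by rw [hcS x hx, hcone x hx, one_mul]⟩

/-- A fundamental system determines the coefficient. The difference of two admissible coefficients
agrees almost everywhere with `d = φ^{[1]} S'^{[1]} - φ'^{[1]} S^{[1]}`, whose derivative vanishes;
and `d(0) = 0` because the quasi-derivatives are normalized at `0`. -/
theorem coefficient_unique (h : IsFundamentalSystem σ φ φ₁ S S₁)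
    (h' : IsFundamentalSystem σ' φ' φ₁' S' S₁') {lam : ℂ}
    (hφ : EqOn (φ' lam) (φ lam) (Icc 0 Real.pi)) (hS : EqOn (S' lam) (S lam) (Icc 0 Real.pi)) :
    (∀ᵐ x ∂volume.restrict (Ioo (0 : ℝ) Real.pi), σ x = σ' x) ∧
      EqOn (φ₁' lam) (φ₁ lam) (Icc 0 Real.pi) ∧ EqOn (S₁' lam) (S₁ lam) (Icc 0 Real.pi) := by
  set d : ℝ → ℂ := fun x ↦ φ₁ lam x * S₁' lam x - φ₁' lam x * S₁ lam x with hd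
  have hdAC : AbsolutelyContinuousOnInterval d 0 Real.pi :=
    ((h.cosine lam).2.fun_smul (h'.sine lam).2).fun_sub
      ((h'.cosine lam).2.fun_smul (h.sine lam).2)
  have key : ∀ᵐ x ∂volume.restrict (Ioo (0 : ℝ) Real.pi),
      φ₁' lam x = φ₁ lam x - (σ' x - σ x) * φ lam x ∧
      S₁' lam x = S₁ lam x - (σ' x - σ x) * S lam x := by
    filter_upwards [(h.cosine lam).3, (h.sine lam).3, (h'.cosine lam).3, (h'.sine lam).3,
      ae_restrict_mem measurableSet_Ioo] with x a1 a2 a3 a4 hx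
    have hnhds : Icc 0 Real.pi ∈ 𝓝 x := Icc_mem_nhds hx.1 hx.2
    have u1 := a3.unique (a1.congr_of_eventuallyEq
      (by filter_upwards [hnhds] with t ht using hφ ht))
    have u2 := a4.unique (a2.congr_of_eventuallyEq
      (by filter_upwards [hnhds] with t ht using hS ht))
    rw [hφ (Ioo_subset_Icc_self hx)] at u1
    rw [hS (Ioo_subset_Icc_self hx)] at u2
    constructor
    · linear_combination u1
    · linear_combination u2
  have hdd : ∀ᵐ x ∂volume.restrict (Ioo (0 : ℝ) Real.pi), HasDerivAt d 0 x := by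
    filter_upwards [key, (h.cosine lam).4, (h.sine lam).4, (h'.cosine lam).4, (h'.sine lam).4,
      ae_restrict_mem measurableSet_Ioo] with x k a1 a2 a3 a4 hx
    convert! (a1.mul a4).sub (a3.mul a2) using 1
    rw [hφ (Ioo_subset_Icc_self hx), hS (Ioo_subset_Icc_self hx), k.1, k.2]
    ring
  have hd0 : ∀ x ∈ Icc 0 Real.pi, d x = 0 := fun x hx ↦ by
    rw [hdAC.eq_left_of_ae_hasDerivAt_zero Real.pi_pos.le hdd hx]
    simp [hd, h.cosine_quasi_zero, h'.cosine_quasi_zero]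
  have hσσ : ∀ᵐ x ∂volume.restrict (Ioo (0 : ℝ) Real.pi), σ x = σ' x := by
    filter_upwards [key, ae_restrict_mem measurableSet_Ioo] with x k hx
    have h1 := hd0 x (Ioo_subset_Icc_self hx)
    have h2 := h.wronskian lam (Ioo_subset_Icc_self hx)
    simp only [hd] at h1
    rw [k.1, k.2] at h1
    linear_combination (σ' x - σ x) * h2 - h1
  refine ⟨hσσ, ?_, ?_⟩
  · refine Measure.eqOn_Icc_of_ae_eq volume Real.pi_pos.ne ?_ (h'.cosine lam).continuousOn_quasi
      (h.cosine lam).continuousOn_quasi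
    rw [← Measure.restrict_congr_set Ioo_ae_eq_Icc]
    filter_upwards [key, hσσ] with x k1 k2
    rw [k1.1, k2]; ring
  · refine Measure.eqOn_Icc_of_ae_eq volume Real.pi_pos.ne ?_ (h'.sine lam).continuousOn_quasi
      (h.sine lam).continuousOn_quasi
    rw [← Measure.restrict_congr_set Ioo_ae_eq_Icc]
    filter_upwards [key, hσσ] with x k1 k2
    rw [k1.2, k2]; ring

end IsFundamentalSystem

/-! ### Recovering the boundary polynomials, and uniqueness -/

open Polynomial in
/-- Proportional coprime normalized pairs coincide: by Bézout the factor of proportionality is a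
polynomial, and a unit. -/
theorem eq_of_mul_eq_mul_of_normalized {r₁ r₂ s₁ s₂ : ℂ[X]} (hr : IsCoprime r₁ r₂)
    (hs : IsCoprime s₁ s₂) (hN : IsNormalizedPair r₁ r₂) (hN' : IsNormalizedPair s₁ s₂)
    (h : r₁ * s₂ = s₁ * r₂) : r₁ = s₁ ∧ r₂ = s₂ := by
  obtain ⟨a, b, hab⟩ := hr
  obtain ⟨a', b', hab'⟩ := hs
  set u := a * s₁ + b * s₂ with hu
  set v := a' * r₁ + b' * r₂ with hv
  have h1 : s₁ = r₁ * u := by rw [hu]; linear_combination -s₁ * hab - b * h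
  have h2 : s₂ = r₂ * u := by rw [hu]; linear_combination -s₂ * hab + a * h
  have h3 : u * v = 1 := by
    rw [hv]; linear_combination hab' - a' * h1 - b' * h2
  obtain ⟨c, hc, hcu⟩ := Polynomial.isUnit_iff.1 (IsUnit.of_mul_eq_one v h3)
  have hc0 : c ≠ 0 := hc.ne_zero
  rw [← hcu, mul_comm] at h1 h2
  have d1 : s₁.degree = r₁.degree := by rw [h1, degree_C_mul hc0]
  have d2 : s₂.degree = r₂.degree := by rw [h2, degree_C_mul hc0]
  have hc1 : c = 1 := by
    rcases hN with ⟨n1, n2⟩ | ⟨n1, n2⟩ <;> rcases hN' with ⟨n3, n4⟩ | ⟨n3, n4⟩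
    · rw [h1, Monic, leadingCoeff_mul, leadingCoeff_C, n2.leadingCoeff, mul_one] at n4; exact n4
    · rw [d1, d2] at n3; exact absurd n1 (not_le.2 n3)
    · rw [d1, d2] at n3; exact absurd n3 (not_le.2 n1)
    · rw [h2, Monic, leadingCoeff_mul, leadingCoeff_C, n2.leadingCoeff, mul_one] at n4; exact n4
  rw [hc1, C_1, one_mul] at h1 h2
  exact ⟨h1.symm, h2.symm⟩

/-- If the Weyl functions of two problems agree at every point where both are defined (the
excluded points are the zeros of two entire functions, so this is equality of meromorphic
functions), then the two problems coincide. -/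
theorem theorem1
    (σ σ' : ℝ → ℂ) (r₁ r₂ r₁' r₂' : Polynomial ℂ)
    (hσ : MeasureTheory.MemLp σ 2
      (MeasureTheory.volume.restrict (Set.Ioo (0 : ℝ) Real.pi)))
    (hσ' : MeasureTheory.MemLp σ' 2
      (MeasureTheory.volume.restrict (Set.Ioo (0 : ℝ) Real.pi)))
    (hr : IsCoprime r₁ r₂) (hr' : IsCoprime r₁' r₂')
    (hN : IsNormalizedPair r₁ r₂) (hN' : IsNormalizedPair r₁' r₂')
    (hM : ∀ lam m m' : ℂ, HasWeylValue σ r₁ r₂ lam m → HasWeylValue σ' r₁' r₂' lam m' →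
      m = m') :
    (∀ᵐ x ∂(MeasureTheory.volume.restrict (Set.Ioo (0 : ℝ) Real.pi)), σ x = σ' x) ∧
      r₁ = r₁' ∧ r₂ = r₂' := by
  obtain ⟨φ, φ₁, S, S₁, h⟩ := exists_isFundamentalSystem hσ
  obtain ⟨φ', φ₁', S', S₁', h'⟩ := exists_isFundamentalSystem hσ'
  obtain ⟨K, hK⟩ := h.exists_weyl_solution hσ hN
  obtain ⟨K', hK'⟩ := h'.exists_weyl_solution hσ' hN'
  have hF : ∀ lam, ∀ x ∈ Icc 0 Real.pi, φ lam x * S' lam x = S lam x * φ' lam x := by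
    intro lam x hx
    refine h.mul_eq_mul_of_weyl hσ hσ' h' (K := max K K') (fun κ hκ hre ↦ ?_) lam hx
    obtain ⟨m, B, -, hm, -, -, hb⟩ := hK κ ((le_max_left _ _).trans hκ) hre
    obtain ⟨m', B', -, hm', -, -, hb'⟩ := hK' κ ((le_max_right _ _).trans hκ) hre
    obtain rfl := hM _ _ _ hm hm'
    exact ⟨m, fun x hx ↦ ⟨hb x hx, hb' x hx⟩⟩
  have hE := fun lam ↦ h.eqOn_of_mul_eq_mul h' (hF lam)
  have hC := fun lam ↦ h.coefficient_unique h' (hE lam).1 (hE lam).2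
  refine ⟨(hC 0).1, eq_of_mul_eq_mul_of_normalized hr hr' hN hN' ?_⟩
  -- both pairs are proportional to the boundary values at `π` of the common Weyl solution
  have hpi : Real.pi ∈ Icc 0 Real.pi := ⟨Real.pi_pos.le, le_rfl⟩
  have heval : ∀ t ∈ Ici (max (max K K') 0),
      (r₁ * r₂').eval (-(t : ℂ) ^ 2) = (r₁' * r₂).eval (-(t : ℂ) ^ 2) := by
    intro t ht
    simp only [mem_Ici, max_le_iff] at ht
    have hn : ‖(t : ℂ)‖ = t := by simp [ht.2]
    have hre : ‖(t : ℂ)‖ ≤ 2 * (t : ℂ).re := by rw [hn, Complex.ofReal_re]; linarith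
    obtain ⟨m, B, -, hm, e1, e2, -⟩ := hK t (by rw [hn]; exact ht.1.1) hre
    obtain ⟨m', B', -, hm', e1', e2', -⟩ := hK' t (by rw [hn]; exact ht.1.2) hre
    obtain rfl := hM _ _ _ hm hm'
    rw [(hE _).1 hpi, (hE _).2 hpi] at e1'
    rw [(hC _).2.1 hpi, (hC _).2.2 hpi] at e2'
    rw [Polynomial.eval_mul, Polynomial.eval_mul, e1, e1', ← neg_neg (r₂.eval _), e2,
      ← neg_neg (r₂'.eval _), e2']
    ring
  refine Polynomial.eq_of_infinite_eval_eq _ _ (Set.Infinite.mono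
    (s := (fun t : ℝ ↦ -(t : ℂ) ^ 2) '' Ici (max (max K K') 0)) ?_ ?_)
  · rintro _ ⟨t, ht, rfl⟩
    exact heval t ht
  · refine (Set.Ici_infinite _).image fun s hs t ht hst ↦ ?_
    simp only [mem_Ici, max_le_iff] at hs ht
    have h1 : s ^ 2 = t ^ 2 := by exact_mod_cast neg_injective hst
    exact (sq_eq_sq₀ hs.2 ht.2).1 h1
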